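/- All spaces are complex. An operator ideal $\mathcal I$ is a class of continuous linear operators between Banach spaces whose components $\mathcal I(E;F)=\mathcal I\cap\mathcal L(E;F)$ are linear subspaces of $\mathcal L(E;F)$ containing the finite rank operators, and such that $S\circ R\circ T\in\mathcal I$ whenever $R\in\mathcal I$ and $S,T$ are composable continuous linear operators. Put $\mathcal I^{dual}(E;F)=\{S\in\mathcal L(E;F): S'\in\mathcal I(F';E')\}$, where $S'$ is the adjoint of $S$. Let $\mathcal L[\mathcal I]$ be the class of continuous $n$-linear mappings ($n\ge 1$) between Banach spaces of the form $B\circ(u_1,\dots,u_n)$ with $u_j\in\mathcal I(E_j;G_j)$, $G_j$ Banach, and $B\in\mathcal L(G_1,\dots,G_n;F)$; let $\mathcal I\circ\mathcal L$ be the class of those of the form $u\circ B$ with $B\in\mathcal L(E_1,\dots,E_n;G)$, $G$ Banach, and $u\in\mathcal I(G;F)$. Inclusions between such classes mean inclusions of all components. A Banach space $E$ has the $\mathcal I$-approximation property ($\mathcal I$-AP) if $\mathcal I(E;E)$ is dense in $\mathcal L(E;E)$ for the compact-open topology. A locally convex space $V$ has the $\mathcal I$-AP if $\mathcal I(V;V)$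 is dense in $\mathcal L(V;V)$ for the compact-open topology, where $\mathcal I(V;V)$ now denotes the set of operators $Y\circ T\circ A$ with $A\in\mathcal L(V;X)$, $T\in\mathcal I(X;Z)$, $Y\in\mathcal L(Z;V)$ for some Banach spaces $X,Z$. For $n\ge 1$, $\mathcal P(^nE)$ is the Banach space of continuous $n$-homogeneous polynomials $P\colon E\to\mathbb C$ with the norm $\sup_{\|x\|\le 1}|P(x)|$; the Banach space $E$ is polynomially reflexive if $\mathcal P(^nE)$ is reflexive for every $n\ge1$. For $U\subseteq E$ open, a bounded set $A\subseteq U$ is $U$-bounded if $A+V\subseteq U$ for some neighbourhood $V$ of $0$, and $\mathcal H_b(U)$ is the locally convex space of holomorphic functions $f\colon U\to\mathbb C$ that are bounded on the $U$-bounded sets, with the topology of uniform convergence on the $U$-bounded sets. Proposition. Let $\mathcal I$ be an operator ideal such that $\mathcal L[\mathcal I]\subseteq\mathcal I\circ\mathcal L$ and such that $\mathcal I\subseteq\mathcal I^{dual}$ or $\mathcal I^{dual}\subseteq\mathcal I$. Let $E$ be a polynomially reflexive Banach space and $U$ a nonempty balanced open subset of $E$. The following are equivalent: (a) $E$ has the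 $\mathcal I$-AP; (b) $\mathcal P(^nE)$ has the $\mathcal I$-AP for every $n\ge 1$; (c) $\mathcal P(^nE)$ has the $\mathcal I$-AP for some $n\ge 1$; (d) $\mathcal H_b(U)$ has the $\mathcal I$-AP. -/

import Mathlib

open scoped Topology Pointwise CompactConvergenceCLM UniformConvergence

universe u

noncomputable section

/-! ### Operator ideals on complex Banach spaces -/

/-- An operator ideal on complex Banach spaces: a class of continuous linear operators whose
components are linear subspaces, contain the finite rank operators, and have the ideal property. -/
structure OperatorIdeal where
  /-- The component `I(E;F)`. -/
  comp : ∀ (E F : Type u) [NormedAddCommGroup E] [NormedSpace ℂ E] [CompleteSpace E]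
    [NormedAddCommGroup F] [NormedSpace ℂ F] [CompleteSpace F], Submodule ℂ (E →L[ℂ] F)
  finiteRank_mem : ∀ {E F : Type u} [NormedAddCommGroup E] [NormedSpace ℂ E] [CompleteSpace E]
    [NormedAddCommGroup F] [NormedSpace ℂ F] [CompleteSpace F] (T : E →L[ℂ] F),
    FiniteDimensional ℂ (LinearMap.range (T : E →ₗ[ℂ] F)) → T ∈ comp E F
  ideal_mem : ∀ {E F G H : Type u} [NormedAddCommGroup E] [NormedSpace ℂ E] [CompleteSpace E]
    [NormedAddCommGroup F] [NormedSpace ℂ F] [CompleteSpace F]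
    [NormedAddCommGroup G] [NormedSpace ℂ G] [CompleteSpace G]
    [NormedAddCommGroup H] [NormedSpace ℂ H] [CompleteSpace H]
    (S : G →L[ℂ] H) (R : F →L[ℂ] G) (T : E →L[ℂ] F),
    R ∈ comp F G → (S.comp R).comp T ∈ comp E H

namespace OperatorIdeal

/-- The component `I^dual(E;F)`: the operators `S : E → F` whose adjoint `S' : F' → E'`,
`S' φ = φ ∘ S`, belongs to `I(F';E')`. -/
def dual (I : OperatorIdeal.{u}) (E F : Type u) [NormedAddCommGroup E] [NormedSpace ℂ E]
    [NormedAddCommGroup F] [NormedSpace ℂ F] : Set (E →L[ℂ] F) :=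
  {S | (ContinuousLinearMap.precomp ℂ S : StrongDual ℂ F →L[ℂ] StrongDual ℂ E) ∈
    I.comp (StrongDual ℂ F) (StrongDual ℂ E)}

/-- The inclusion `I ⊆ I^dual`. -/
def LeDual (I : OperatorIdeal.{u}) : Prop :=
  ∀ (E F : Type u) [NormedAddCommGroup E] [NormedSpace ℂ E] [CompleteSpace E]
    [NormedAddCommGroup F] [NormedSpace ℂ F] [CompleteSpace F],
    (I.comp E F : Set (E →L[ℂ] F)) ⊆ I.dual E F

/-- The inclusion `I^dual ⊆ I`. -/
def DualLe (I : OperatorIdeal.{u}) : Prop :=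
  ∀ (E F : Type u) [NormedAddCommGroup E] [NormedSpace ℂ E] [CompleteSpace E]
    [NormedAddCommGroup F] [NormedSpace ℂ F] [CompleteSpace F],
    I.dual E F ⊆ (I.comp E F : Set (E →L[ℂ] F))

/-- Factorization method: the set `L[I](E₁,…,Eₙ;F)` of all continuous `n`-linear mappings of the
form `B ∘ (u₁,…,uₙ)` with `uⱼ ∈ I(Eⱼ;Gⱼ)`, `Gⱼ` Banach, `B` continuous `n`-linear. -/
def factorization (I : OperatorIdeal.{u}) {n : ℕ} (E : Fin n → Type u) (F : Type u)
    [∀ j, NormedAddCommGroup (E j)] [∀ j, NormedSpace ℂ (E j)] [∀ j, CompleteSpace (E j)]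
    [NormedAddCommGroup F] [NormedSpace ℂ F] : Set (ContinuousMultilinearMap ℂ E F) :=
  {A | ∃ (G : Fin n → Type u) (_ : ∀ j, NormedAddCommGroup (G j))
      (_ : ∀ j, NormedSpace ℂ (G j)) (_ : ∀ j, CompleteSpace (G j))
      (v : ∀ j, E j →L[ℂ] G j) (B : ContinuousMultilinearMap ℂ G F),
      (∀ j, v j ∈ I.comp (E j) (G j)) ∧ A = B.compContinuousLinearMap v}

/-- Composition method: the set `(I ∘ L)(E₁,…,Eₙ;F)` of all continuous `n`-linear mappings of the
form `v ∘ B` with `B : E₁ × ⋯ × Eₙ → G` continuous `n`-linear, `G` Banach, `v ∈ I(G;F)`. -/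
def composition (I : OperatorIdeal.{u}) {n : ℕ} (E : Fin n → Type u) (F : Type u)
    [∀ j, NormedAddCommGroup (E j)] [∀ j, NormedSpace ℂ (E j)]
    [NormedAddCommGroup F] [NormedSpace ℂ F] [CompleteSpace F] :
    Set (ContinuousMultilinearMap ℂ E F) :=
  {A | ∃ (G : Type u) (_ : NormedAddCommGroup G) (_ : NormedSpace ℂ G) (_ : CompleteSpace G)
      (B : ContinuousMultilinearMap ℂ E G) (v : G →L[ℂ] F),
      v ∈ I.comp G F ∧ A = v.compContinuousMultilinearMap B}

/-- The inclusion `L[I] ⊆ I ∘ L`, for `n`-linear mappings of every degree `n ≥ 1`. -/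
def FactorizationLeComposition (I : OperatorIdeal.{u}) : Prop :=
  ∀ (n : ℕ), 1 ≤ n → ∀ (E : Fin n → Type u) (F : Type u)
    [∀ j, NormedAddCommGroup (E j)] [∀ j, NormedSpace ℂ (E j)] [∀ j, CompleteSpace (E j)]
    [NormedAddCommGroup F] [NormedSpace ℂ F] [CompleteSpace F],
    I.factorization E F ⊆ I.composition E F

/-- The `I`-approximation property of a Banach space `E`: `I(E;E)` is dense in `L(E;E)` for the
compact-open topology. -/
def HasAP (I : OperatorIdeal.{u}) (E : Type u) [NormedAddCommGroup E] [NormedSpace ℂ E]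
    [CompleteSpace E] : Prop :=
  closure (UniformConvergenceCLM.ofFun (RingHom.id ℂ) E {K : Set E | IsCompact K} ''
    (I.comp E E : Set (E →L[ℂ] E)) : Set (E →L_c[ℂ] E)) = Set.univ

/-- The inferior extension of `I` to topological vector spaces: the continuous linear operators
`V → W` which factor as `Y ∘ T ∘ A` with `T ∈ I(E;F)` for some Banach spaces `E` and `F`. -/
def infExt (I : OperatorIdeal.{u}) (V W : Type u) [AddCommGroup V] [Module ℂ V]
    [TopologicalSpace V] [AddCommGroup W] [Module ℂ W] [TopologicalSpace W] : Set (V →L[ℂ] W) :=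
  {S | ∃ (E F : Type u) (_ : NormedAddCommGroup E) (_ : NormedSpace ℂ E) (_ : CompleteSpace E)
      (_ : NormedAddCommGroup F) (_ : NormedSpace ℂ F) (_ : CompleteSpace F)
      (A : V →L[ℂ] E) (T : E →L[ℂ] F) (Y : F →L[ℂ] W), T ∈ I.comp E F ∧ S = (Y.comp T).comp A}

/-- The `I`-approximation property of a locally convex space `V`, with respect to the inferior
extension of `I`. -/
def HasAPLC (I : OperatorIdeal.{u}) (V : Type u) [AddCommGroup V] [Module ℂ V]
    [TopologicalSpace V] [IsTopologicalAddGroup V] [ContinuousSMul ℂ V] : Prop :=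
  closure (UniformConvergenceCLM.ofFun (RingHom.id ℂ) V {K : Set V | IsCompact K} ''
    I.infExt V V : Set (V →L_c[ℂ] V)) = Set.univ

end OperatorIdeal

/-! ### The Banach space of continuous homogeneous polynomials -/

/-- The functions `x ↦ A (x, …, x)` with `A` a continuous `n`-linear form on `E`, as a linear
space. -/
def homPolySubmodule (n : ℕ) (E : Type u) [NormedAddCommGroup E] [NormedSpace ℂ E] :
    Submodule ℂ (E → ℂ) where
  carrier := {P | ∃ A : ContinuousMultilinearMap ℂ (fun _ : Fin n => E) ℂ,
    ∀ x, P x = A (fun _ => x)}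
  add_mem' := by
    rintro P Q ⟨A, hA⟩ ⟨B, hB⟩
    exact ⟨A + B, fun x => by simp [hA, hB]⟩
  zero_mem' := ⟨0, fun x => by simp⟩
  smul_mem' := by
    rintro c P ⟨A, hA⟩
    exact ⟨c • A, fun x => by simp [hA]⟩

/-- The space `P(ⁿE)` of continuous `n`-homogeneous (complex valued) polynomials on `E`, which is
given the norm `‖P‖ = sup_{‖x‖ ≤ 1} |P x|` below. -/
def HomPoly (n : ℕ) (E : Type u) [NormedAddCommGroup E] [NormedSpace ℂ E] : Type u :=
  homPolySubmodule n E

namespace HomPoly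

variable {n : ℕ} {E : Type u} [NormedAddCommGroup E] [NormedSpace ℂ E]

instance instAddCommGroup : AddCommGroup (HomPoly n E) :=
  inferInstanceAs (AddCommGroup (homPolySubmodule n E))

instance instModule : Module ℂ (HomPoly n E) :=
  inferInstanceAs (Module ℂ (homPolySubmodule n E))

instance instCoeFun : CoeFun (HomPoly n E) (fun _ => E → ℂ) := ⟨fun P => P.1⟩

theorem ext {P Q : HomPoly n E} (h : ∀ x, P x = Q x) : P = Q := Subtype.ext (funext h)

@[simp] theorem add_apply (P Q : HomPoly n E) (x : E) : (P + Q) x = P x + Q x := rfl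

@[simp] theorem smul_apply (c : ℂ) (P : HomPoly n E) (x : E) : (c • P) x = c * P x := rfl

@[simp] theorem zero_apply (x : E) : (0 : HomPoly n E) x = 0 := rfl

instance instNorm : Norm (HomPoly n E) := ⟨fun P => ⨆ x : {x : E // ‖x‖ ≤ 1}, ‖P x‖⟩

theorem norm_def (P : HomPoly n E) : ‖P‖ = ⨆ x : {x : E // ‖x‖ ≤ 1}, ‖P x‖ := rfl

theorem apply_smul (P : HomPoly n E) (c : ℂ) (x : E) : P (c • x) = c ^ n * P x := by
  obtain ⟨A, hA⟩ := P.2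
  rw [hA, hA, A.map_smul_univ (fun _ => c) (fun _ => x)]
  simp

theorem bddAbove (P : HomPoly n E) :
    BddAbove (Set.range fun x : {x : E // ‖x‖ ≤ 1} => ‖P x‖) := by
  obtain ⟨A, hA⟩ := P.2
  refine ⟨‖A‖, ?_⟩
  rintro _ ⟨x, rfl⟩
  simp only [hA]
  refine (A.le_opNorm _).trans ?_
  simpa using mul_le_of_le_one_right (norm_nonneg A) (pow_le_one₀ (norm_nonneg _) x.2)

theorem apply_le_norm (P : HomPoly n E) {x : E} (hx : ‖x‖ ≤ 1) : ‖P x‖ ≤ ‖P‖ :=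
  le_ciSup P.bddAbove ⟨x, hx⟩

theorem norm_le (P : HomPoly n E) {C : ℝ} (h : ∀ x : E, ‖x‖ ≤ 1 → ‖P x‖ ≤ C) : ‖P‖ ≤ C :=
  haveI : Nonempty {x : E // ‖x‖ ≤ 1} := ⟨⟨0, by simp⟩⟩
  ciSup_le fun x => h x x.2

theorem apply_le (P : HomPoly n E) (x : E) : ‖P x‖ ≤ ‖P‖ * ‖x‖ ^ n := by
  rcases eq_or_ne x 0 with rfl | hx
  · have h := P.apply_smul 0 0
    rw [zero_smul] at h
    rw [h, norm_mul, norm_pow, norm_zero, norm_zero, mul_comm]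
    exact mul_le_mul_of_nonneg_right (P.apply_le_norm (by simp)) (by positivity)
  · have hx' : (‖x‖ : ℂ) ≠ 0 := by simpa using hx
    have h := P.apply_smul (‖x‖ : ℂ) ((‖x‖ : ℂ)⁻¹ • x)
    rw [smul_smul, mul_inv_cancel₀ hx', one_smul] at h
    rw [h, norm_mul, norm_pow, mul_comm]
    simp only [Complex.norm_real, norm_norm]
    refine mul_le_mul_of_nonneg_right (P.apply_le_norm ?_) (by positivity)
    rw [norm_smul, norm_inv, Complex.norm_real, norm_norm,
      inv_mul_cancel₀ (by simpa using hx)]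

theorem core : NormedSpace.Core ℂ (HomPoly n E) where
  norm_nonneg P := (norm_nonneg _).trans (P.apply_le_norm (x := 0) (by simp))
  norm_smul c P := by
    rw [norm_def, norm_def, Real.mul_iSup_of_nonneg (norm_nonneg c)]
    simp
  norm_triangle P Q := norm_le _ fun x hx => by
    rw [add_apply]
    exact (norm_add_le _ _).trans (add_le_add (P.apply_le_norm hx) (Q.apply_le_norm hx))
  norm_eq_zero_iff P := by
    constructor
    · intro h
      refine ext fun x => ?_
      have := P.apply_le x
      rw [h, zero_mul] at this
      simpa using norm_le_zero_iff.1 this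
    · rintro rfl
      simp [norm_def]

instance instNormedAddCommGroup : NormedAddCommGroup (HomPoly n E) :=
  NormedAddCommGroup.ofCore core

instance instNormedSpace : NormedSpace ℂ (HomPoly n E) := NormedSpace.ofCore core

/-- The polynomial `x ↦ A (x, …, x)`, as a continuous linear function of `A`. -/
def diag (n : ℕ) (E : Type u) [NormedAddCommGroup E] [NormedSpace ℂ E] :
    ContinuousMultilinearMap ℂ (fun _ : Fin n => E) ℂ →L[ℂ] HomPoly n E :=
  LinearMap.mkContinuous
    { toFun := fun A => ⟨fun x => A (fun _ => x), A, fun _ => rfl⟩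
      map_add' := fun _ _ => rfl
      map_smul' := fun _ _ => rfl } 1 fun A => by
    refine norm_le _ fun x hx => ?_
    rw [one_mul]
    refine (A.le_opNorm _).trans ?_
    simpa using mul_le_of_le_one_right (norm_nonneg A) (pow_le_one₀ (norm_nonneg _) hx)

theorem diag_apply (A : ContinuousMultilinearMap ℂ (fun _ : Fin n => E) ℂ) (x : E) :
    diag n E A x = A (fun _ => x) := rfl

/-- The polarization formula. -/
theorem polarization (A : ContinuousMultilinearMap ℂ (fun _ : Fin n => E) ℂ) (x : Fin n → E) :
    ∑ ε : Fin n → ℤˣ, ((∏ i, (ε i : ℤ) : ℤ) : ℂ) *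
        A (fun _ => ∑ i, (((ε i : ℤ) : ℂ)) • x i) =
      2 ^ n * ∑ σ : Equiv.Perm (Fin n), A (fun j => x (σ j)) := by
  have expand : ∀ ε : Fin n → ℤˣ, A (fun _ => ∑ i, (((ε i : ℤ) : ℂ)) • x i) =
      ∑ r : Fin n → Fin n, ((∏ j, (ε (r j) : ℤ) : ℤ) : ℂ) * A (fun j => x (r j)) := by
    intro ε
    rw [A.map_sum]
    refine Finset.sum_congr rfl fun r _ => ?_
    rw [A.map_smul_univ (fun j => (((ε (r j) : ℤ) : ℂ))) (fun j => x (r j))]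
    simp
  simp_rw [expand, Finset.mul_sum]
  rw [Finset.sum_comm]
  have key : ∀ r : Fin n → Fin n, ¬ Function.Bijective r →
      ∑ ε : Fin n → ℤˣ, (∏ i, ε i : ℤˣ).val * (∏ j, ε (r j) : ℤˣ).val = (0 : ℤ) := by
    intro r hr
    have hs : ¬ Function.Surjective r := fun h => hr (Finite.injective_iff_bijective.1
      (Finite.injective_iff_surjective.2 h))
    simp only [Function.Surjective, not_forall, not_exists] at hs
    obtain ⟨i₀, hi₀⟩ := hs
    have h := Equiv.sum_comp (Equiv.mulRight (Pi.mulSingle i₀ (-1) : Fin n → ℤˣ))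
      (fun ε => (∏ i, ε i : ℤˣ).val * (∏ j, ε (r j) : ℤˣ).val)
    have h2 : ∀ ε : Fin n → ℤˣ,
        (∏ i, (Equiv.mulRight (Pi.mulSingle i₀ (-1) : Fin n → ℤˣ) ε) i : ℤˣ).val *
          (∏ j, (Equiv.mulRight (Pi.mulSingle i₀ (-1) : Fin n → ℤˣ) ε) (r j) : ℤˣ).val =
        - ((∏ i, ε i : ℤˣ).val * (∏ j, ε (r j) : ℤˣ).val) := by
      intro ε
      have e1 : ∀ j, (Pi.mulSingle i₀ (-1) : Fin n → ℤˣ) (r j) = 1 := fun j =>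
        Pi.mulSingle_eq_of_ne (hi₀ j) _
      simp [Finset.prod_mul_distrib, e1]
    simp only [h2, Finset.sum_neg_distrib] at h
    lia
  have key2 : ∀ r : Fin n → Fin n, Function.Bijective r →
      ∑ ε : Fin n → ℤˣ, (∏ i, ε i : ℤˣ).val * (∏ j, ε (r j) : ℤˣ).val = (2 ^ n : ℤ) := by
    intro r hr
    have : ∀ ε : Fin n → ℤˣ, (∏ i, ε i : ℤˣ).val * (∏ j, ε (r j) : ℤˣ).val = (1 : ℤ) := by
      intro ε
      rw [hr.prod_comp ε, ← Units.val_mul, Int.units_mul_self, Units.val_one]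
    rw [Finset.sum_congr rfl fun ε _ => this ε]
    simp
  have key3 : ∀ r : Fin n → Fin n,
      ∑ ε : Fin n → ℤˣ, ((∏ i, (ε i : ℤ) : ℤ) : ℂ) *
        (((∏ j, (ε (r j) : ℤ) : ℤ) : ℂ) * A (fun j => x (r j))) =
      ((∑ ε : Fin n → ℤˣ, (∏ i, ε i : ℤˣ).val * (∏ j, ε (r j) : ℤˣ).val : ℤ) : ℂ) *
        A (fun j => x (r j)) := by
    intro r
    push_cast
    rw [Finset.sum_mul]
    refine Finset.sum_congr rfl fun ε _ => ?_
    ring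
  simp_rw [key3]
  rw [← Finset.sum_filter_of_ne (p := Function.Bijective)]
  · symm
    refine Finset.sum_bij (fun σ _ => (σ : Fin n → Fin n)) ?_ ?_ ?_ ?_
    · intro σ _
      exact Finset.mem_filter.2 ⟨Finset.mem_univ _, σ.bijective⟩
    · intro σ _ τ _ h
      exact Equiv.coe_fn_injective h
    · intro r hr
      exact ⟨Equiv.ofBijective r (Finset.mem_filter.1 hr).2, Finset.mem_univ _, rfl⟩
    · intro σ _
      rw [key2 σ σ.bijective]
      push_cast
      rfl
  · intro r _ h
    by_contra hr
    exact h (by rw [key r hr, Int.cast_zero, zero_mul])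

/-- Every continuous homogeneous polynomial is the diagonal of a continuous multilinear form whose
norm it controls. -/
theorem exists_bound (n : ℕ) (E : Type u) [NormedAddCommGroup E] [NormedSpace ℂ E] :
    ∃ C : ℝ, ∀ P : HomPoly n E, ∃ B, diag n E B = P ∧ ‖B‖ ≤ C * ‖P‖ := by
  refine ⟨(2 ^ n * (n.factorial : ℝ))⁻¹ * (2 ^ n * (n : ℝ) ^ n), fun P => ?_⟩
  obtain ⟨A, hA⟩ := P.2
  set B : ContinuousMultilinearMap ℂ (fun _ : Fin n => E) ℂ :=
    ((n.factorial : ℂ)⁻¹) • ∑ σ : Equiv.Perm (Fin n), A.domDomCongr σ with hB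
  have hBx : ∀ x, B x = (n.factorial : ℂ)⁻¹ * ∑ σ : Equiv.Perm (Fin n), A (fun j => x (σ j)) := by
    intro x
    simp [hB]
  have hfac : (n.factorial : ℂ) ≠ 0 := by exact_mod_cast n.factorial_ne_zero
  refine ⟨B, ext fun x => ?_, ?_⟩
  · rw [diag_apply, hBx, hA]
    simp [Fintype.card_perm, hfac]
  have unit : ∀ x : Fin n → E, (∀ i, ‖x i‖ ≤ 1) →
      ‖B x‖ ≤ (2 ^ n * (n.factorial : ℝ))⁻¹ * (2 ^ n * (n : ℝ) ^ n) * ‖P‖ := by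
    intro x hx
    have hpol := polarization A x
    have e : B x = (2 ^ n * (n.factorial : ℂ))⁻¹ *
        ∑ ε : Fin n → ℤˣ, ((∏ i, (ε i : ℤ) : ℤ) : ℂ) *
          A (fun _ => ∑ i, (((ε i : ℤ) : ℂ)) • x i) := by
      rw [hpol, hBx]
      field_simp
    have unorm : ∀ z : ℤˣ, ‖((z : ℤ) : ℂ)‖ = 1 := by
      intro z
      rcases Int.units_eq_one_or z with rfl | rfl <;> simp
    rw [e, norm_mul, norm_inv, norm_mul, norm_pow, mul_assoc]
    simp only [RCLike.norm_ofNat, RCLike.norm_natCast]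
    refine mul_le_mul_of_nonneg_left ?_ (by positivity)
    refine (norm_sum_le _ _).trans ?_
    have term : ∀ ε : Fin n → ℤˣ, ‖((∏ i, (ε i : ℤ) : ℤ) : ℂ) *
        A (fun _ => ∑ i, (((ε i : ℤ) : ℂ)) • x i)‖ ≤ (n : ℝ) ^ n * ‖P‖ := by
      intro ε
      rw [norm_mul, ← hA]
      have h1 : ‖((∏ i, (ε i : ℤ) : ℤ) : ℂ)‖ = 1 := by
        push_cast
        rw [norm_prod]
        exact Finset.prod_eq_one fun i _ => unorm (ε i)
      rw [h1, one_mul, mul_comm]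
      refine (P.apply_le _).trans ?_
      refine mul_le_mul_of_nonneg_left ?_ (norm_nonneg P)
      refine pow_le_pow_left₀ (norm_nonneg _) ?_ n
      refine (norm_sum_le _ _).trans ?_
      refine (Finset.sum_le_sum (g := fun _ => (1 : ℝ)) fun i _ => ?_).trans (by simp)
      rw [norm_smul, unorm, one_mul]
      exact hx i
    refine (Finset.sum_le_sum fun ε _ => term ε).trans ?_
    simp [mul_assoc]
  refine ContinuousMultilinearMap.opNorm_le_bound (by positivity) fun x => ?_
  by_cases h0 : ∃ i, x i = 0
  · obtain ⟨i, hi⟩ := h0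
    rw [B.map_coord_zero i hi, norm_zero]
    positivity
  push Not at h0
  have hx : x = fun i => (‖x i‖ : ℂ) • ((‖x i‖ : ℂ)⁻¹ • x i) := by
    funext i
    rw [smul_smul, mul_inv_cancel₀ (by simpa using h0 i), one_smul]
  have hsm := B.map_smul_univ (fun i => (‖x i‖ : ℂ)) (fun i => (‖x i‖ : ℂ)⁻¹ • x i)
  rw [← hx] at hsm
  rw [hsm, norm_smul, norm_prod, mul_comm]
  simp only [Complex.norm_real, norm_norm]
  refine mul_le_mul_of_nonneg_right (unit _ fun i => ?_)
    (Finset.prod_nonneg fun i _ => norm_nonneg _)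
  rw [norm_smul, norm_inv, Complex.norm_real, norm_norm,
    inv_mul_cancel₀ (by simpa using h0 i)]

instance instCompleteSpace : CompleteSpace (HomPoly n E) := by
  refine NormedAddCommGroup.completeSpace_of_summable_imp_tendsto fun P hP => ?_
  obtain ⟨C, hC⟩ := exists_bound n E
  choose B hB hBn using hC
  have hs : Summable fun k => B (P k) :=
    Summable.of_norm_bounded (hP.mul_left C) fun k => hBn (P k)
  refine ⟨diag n E (∑' k, B (P k)), ?_⟩
  have h := (hs.hasSum.mapL (diag n E)).tendsto_sum_nat
  simpa [hB] using h

end HomPoly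

/-- A normed space is reflexive if its canonical embedding into its bidual is onto. -/
def IsReflexiveSpace (E : Type u) [NormedAddCommGroup E] [NormedSpace ℂ E] : Prop :=
  Function.Surjective (NormedSpace.inclusionInDoubleDual ℂ E)

/-- `E` is polynomially reflexive if `P(ⁿE)` is reflexive for every `n ≥ 1`. -/
def PolynomiallyReflexive (E : Type u) [NormedAddCommGroup E] [NormedSpace ℂ E] : Prop :=
  ∀ n : ℕ, 1 ≤ n → IsReflexiveSpace (HomPoly n E)

/-! ### Holomorphic functions of bounded type -/

section HolomorphicBoundedType

variable {E : Type u} [NormedAddCommGroup E] [NormedSpace ℂ E]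

/-- The `U`-bounded sets: the bounded sets `A ⊆ U` such that `A + V ⊆ U` for some neighborhood `V`
of `0`. (They are given as subsets of the subtype `U`.) -/
def uBounded (U : Set E) : Set (Set U) :=
  {A | Bornology.IsBounded (Subtype.val '' A : Set E) ∧
    ∃ V ∈ 𝓝 (0 : E), (Subtype.val '' A : Set E) + V ⊆ U}

/-- For `U` open, the holomorphic functions of bounded type `f : U → ℂ`: `f` has a power series
expansion (in continuous homogeneous polynomials) around each point of `U`, and is bounded on
`U`-bounded sets. They form a subspace of the space of all functions `U → ℂ`, which carries the
topology of uniform convergence on the `U`-bounded sets. -/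
def hbSubmodule (U : Set E) : Submodule ℂ (U →ᵤ[uBounded U] ℂ) where
  carrier := {f | (∃ g : E → ℂ, AnalyticOnNhd ℂ g U ∧
      ∀ x : U, UniformOnFun.toFun (uBounded U) f x = g x) ∧
    ∀ A ∈ uBounded U, Bornology.IsBounded (UniformOnFun.toFun (uBounded U) f '' A)}
  add_mem' := by
    rintro f₁ f₂ ⟨⟨g₁, hg₁, h₁⟩, hb₁⟩ ⟨⟨g₂, hg₂, h₂⟩, hb₂⟩
    refine ⟨⟨g₁ + g₂, hg₁.add hg₂, fun x => ?_⟩, fun A hA => ?_⟩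
    · simp [h₁, h₂]
    · refine ((hb₁ A hA).add (hb₂ A hA)).subset ?_
      rintro _ ⟨x, hx, rfl⟩
      exact Set.add_mem_add ⟨x, hx, rfl⟩ ⟨x, hx, rfl⟩
  zero_mem' := by
    refine ⟨⟨0, fun _ _ => analyticAt_const, fun x => by simp⟩, fun A _ => ?_⟩
    refine (Bornology.isBounded_singleton (x := (0 : ℂ))).subset ?_
    rintro _ ⟨x, _, rfl⟩
    simp
  smul_mem' := by
    rintro c f ⟨⟨g, hg, h⟩, hb⟩
    refine ⟨⟨c • g, fun x hx => (hg x hx).const_smul, fun x => ?_⟩, fun A hA => ?_⟩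
    · simp [h]
    · refine ((hb A hA).smul₀ c).subset ?_
      rintro _ ⟨x, hx, rfl⟩
      exact Set.smul_mem_smul_set ⟨x, hx, rfl⟩

/-- The locally convex space `H_b(U)` of holomorphic functions of bounded type on `U`, with the
topology of uniform convergence on `U`-bounded sets. -/
abbrev Hb (U : Set E) : Type u := hbSubmodule U

instance Hb.instContinuousSMul (U : Set E) : ContinuousSMul ℂ (Hb U) :=
  UniformOnFun.continuousSMul_submodule_of_image_bounded ℂ U ℂ (hbSubmodule U)
    fun _ hf A hA => (NormedSpace.isVonNBounded_iff ℂ).2 (hf.2 A hA)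

end HolomorphicBoundedType

end

/-!
The proof rests on a duality description of the `I`-approximation property. By Grothendieck's
criterion (`exists_approx_id_of_trace`), a subspace of operators on a Banach space approximates the
identity on compact sets as soon as every trace form `R ↦ ∑ φᵢ (R xᵢ)` that vanishes on it vanishes
at the identity: compact sets are controlled by null families, and the dual of the space of null
families in `X` consists of absolutely summable families of functionals.

Let `P(ⁿE)` be reflexive. Then its dual plays the part of the symmetric projective tensor power of
`E`: each of its elements is an absolutely convergent series of evaluations at points of the unit
ball (`HomPoly.exists_hasSum_eval`), and continuous `n`-linear maps on `E` linearize through it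
(`HomPoly.exists_linearization`). For `T ∈ I(E;E)`, the inclusion `L[I] ⊆ I ∘ L` makes the adjoint
of `P ↦ P ∘ T` a member of `I`; since operators on reflexive spaces agree with their second
adjoints, either inclusion between `I` and `I^dual` makes `P ↦ P ∘ T` itself a member of `I`
(`OperatorIdeal.compRight_mem`). A trace form on `P(ⁿE)` is now a series `∑ λⱼ Pⱼ(T xⱼ)` when
applied to these operators, with `xⱼ → 0` after rescaling, and the approximation property of `E`
lets `T` tend to the identity in it. This gives `OperatorIdeal.HasAP.homPoly`.

Conversely, `φ ↦ φ ψᵐ` embeds the dual `E'` as a complemented subspace of `P(ᵐ⁺¹E)`, and `E'` is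
also complemented in `H_b(U)`, so the approximation property of these spaces passes to `E'`. It then
passes to `E`, because `E ≅ E''` is the space of `1`-homogeneous polynomials on `E'`, to which
`OperatorIdeal.HasAP.homPoly` applies. Finally, on a balanced `U` Taylor series at `0` converge
uniformly on compact subsets of `H_b(U)`, by Cauchy estimates on the sets `s A`, `s > 1`. The
approximation property of `H_b(U)` thus follows from that of all the spaces `P(ⁿE)`, the space
`P(⁰E)` being one-dimensional (`OperatorIdeal.hasAPLC_hb`).
-/

open Filter Set

/-! ### Approximating the identity on compact sets -/

/-- For a set of operators stable under composition on the left, density in the compact-open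
topology only has to be tested at the identity. -/
theorem closure_ofFun_image_eq_univ_iff {V : Type u} [AddCommGroup V] [Module ℂ V]
    [TopologicalSpace V] [IsTopologicalAddGroup V] [ContinuousSMul ℂ V] {C : Set (V →L[ℂ] V)}
    (hC : ∀ T : V →L[ℂ] V, ∀ S ∈ C, T.comp S ∈ C) :
    closure (UniformConvergenceCLM.ofFun (RingHom.id ℂ) V {K : Set V | IsCompact K} '' C :
      Set (V →L_c[ℂ] V)) = univ ↔
    ∀ K : Set V, IsCompact K → ∀ W ∈ 𝓝 (0 : V), ∃ S ∈ C, ∀ x ∈ K, S x - x ∈ W := by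
  constructor
  · intro h K hK W hW
    have hid : UniformConvergenceCLM.ofFun (RingHom.id ℂ) V {K : Set V | IsCompact K}
        (ContinuousLinearMap.id ℂ V) ∈ closure (UniformConvergenceCLM.ofFun (RingHom.id ℂ) V
          {K : Set V | IsCompact K} '' C : Set (V →L_c[ℂ] V)) := h ▸ mem_univ _
    have hb : {f : V →L_c[ℂ] V | ∀ x ∈ K, f x ∈ W} ∈ 𝓝 (0 : V →L_c[ℂ] V) :=
      CompactConvergenceCLM.hasBasis_nhds_zero.mem_of_mem (i := (K, W)) ⟨hK, hW⟩
    have hb' : (fun f : V →L_c[ℂ] V => f - UniformConvergenceCLM.ofFun (RingHom.id ℂ) V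
        {K : Set V | IsCompact K} (ContinuousLinearMap.id ℂ V)) ⁻¹'
          {f : V →L_c[ℂ] V | ∀ x ∈ K, f x ∈ W} ∈
        𝓝 (UniformConvergenceCLM.ofFun (RingHom.id ℂ) V {K : Set V | IsCompact K}
          (ContinuousLinearMap.id ℂ V)) := by
      refine (continuous_id.sub continuous_const).continuousAt.preimage_mem_nhds ?_
      simpa using hb
    obtain ⟨_, hf, S, hS, rfl⟩ := mem_closure_iff_nhds.1 hid _ hb'
    exact ⟨S, hS, fun x hx => hf x hx⟩
  · intro h
    refine eq_univ_of_forall fun T => ?_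
    rw [mem_closure_iff_nhds]
    intro N hN
    have hN' : (fun f : V →L_c[ℂ] V => f + T) ⁻¹' N ∈ 𝓝 (0 : V →L_c[ℂ] V) := by
      refine (continuous_id.add continuous_const).continuousAt.preimage_mem_nhds ?_
      simpa using hN
    obtain ⟨⟨K, W⟩, ⟨hK, hW⟩, hsub⟩ := CompactConvergenceCLM.hasBasis_nhds_zero.mem_iff.1 hN'
    obtain ⟨T, rfl⟩ := (UniformConvergenceCLM.ofFun (RingHom.id ℂ) V
      {K : Set V | IsCompact K}).surjective T
    obtain ⟨S, hS, hSK⟩ := h K hK (T ⁻¹' W)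
      (T.continuous.continuousAt.preimage_mem_nhds (by simpa using hW))
    refine ⟨UniformConvergenceCLM.ofFun (RingHom.id ℂ) V {K : Set V | IsCompact K} (T.comp S),
      ?_, _, hC T S hS, rfl⟩
    have := @hsub (UniformConvergenceCLM.ofFun (RingHom.id ℂ) V {K : Set V | IsCompact K}
      (T.comp S) - UniformConvergenceCLM.ofFun (RingHom.id ℂ) V {K : Set V | IsCompact K} T) ?_
    · simpa using this
    · intro x hx
      have h1 := hSK x hx
      simp only [mem_preimage, map_sub] at h1
      exact h1

namespace OperatorIdeal

variable {I : OperatorIdeal.{u}}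

section Banach

variable {X Y Z : Type u} [NormedAddCommGroup X] [NormedSpace ℂ X] [CompleteSpace X]
  [NormedAddCommGroup Y] [NormedSpace ℂ Y] [CompleteSpace Y]
  [NormedAddCommGroup Z] [NormedSpace ℂ Z] [CompleteSpace Z]

theorem comp_mem_left (S : Y →L[ℂ] Z) {R : X →L[ℂ] Y} (hR : R ∈ I.comp X Y) :
    S.comp R ∈ I.comp X Z := by
  simpa using I.ideal_mem S R (ContinuousLinearMap.id ℂ X) hR

theorem comp_mem_right {R : Y →L[ℂ] Z} (hR : R ∈ I.comp Y Z) (T : X →L[ℂ] Y) :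
    R.comp T ∈ I.comp X Z := by
  simpa using I.ideal_mem (ContinuousLinearMap.id ℂ Z) R T hR

theorem hasAP_iff : I.HasAP X ↔ ∀ K : Set X, IsCompact K → ∀ ε > 0,
    ∃ S ∈ I.comp X X, ∀ x ∈ K, ‖S x - x‖ < ε := by
  refine (closure_ofFun_image_eq_univ_iff fun T S hS => comp_mem_left T hS).trans ?_
  constructor
  · intro h K hK ε hε
    simpa using h K hK _ (Metric.ball_mem_nhds 0 hε)
  · intro h K hK W hW
    obtain ⟨ε, hε, hW⟩ := Metric.mem_nhds_iff.1 hW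
    obtain ⟨S, hS, hSK⟩ := h K hK ε hε
    exact ⟨S, hS, fun x hx => hW (by simpa using hSK x hx)⟩

/-- The `I`-approximation property passes to complemented subspaces. -/
theorem HasAP.of_retract (h : I.HasAP Y) (i : X →L[ℂ] Y) (p : Y →L[ℂ] X)
    (hpi : ∀ x, p (i x) = x) : I.HasAP X := by
  rw [hasAP_iff] at h ⊢
  intro K hK ε hε
  obtain ⟨S, hS, hSK⟩ := h (i '' K) (hK.image i.continuous) (ε / (‖p‖ + 1)) (by positivity)
  refine ⟨(p.comp S).comp i, I.ideal_mem p S i hS, fun x hx => ?_⟩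
  have h1 := hSK (i x) (mem_image_of_mem _ hx)
  have h2 : ((p.comp S).comp i) x - x = p (S (i x) - i x) := by simp [hpi]
  rw [h2]
  calc ‖p (S (i x) - i x)‖ ≤ ‖p‖ * ‖S (i x) - i x‖ := p.le_opNorm _
    _ ≤ (‖p‖ + 1) * ‖S (i x) - i x‖ := by gcongr; linarith
    _ < ε := by rw [lt_div_iff₀ (by positivity)] at h1; linarith

end Banach

section LocallyConvex

variable {V : Type u} [AddCommGroup V] [Module ℂ V] [TopologicalSpace V]

theorem comp_mem_infExt (T : V →L[ℂ] V) {S : V →L[ℂ] V} (hS : S ∈ I.infExt V V) :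
    T.comp S ∈ I.infExt V V := by
  obtain ⟨E, F, _, _, _, _, _, _, A, R, Y, hR, rfl⟩ := hS
  exact ⟨E, F, _, _, _, _, _, _, A, R, T.comp Y, hR, rfl⟩

theorem zero_mem_infExt : (0 : V →L[ℂ] V) ∈ I.infExt V V := by
  refine ⟨PUnit, PUnit, inferInstance, inferInstance, inferInstance, inferInstance,
    inferInstance, inferInstance, 0, 0, 0, Submodule.zero_mem _, ?_⟩
  ext; simp

theorem add_mem_infExt [IsTopologicalAddGroup V] {S₁ S₂ : V →L[ℂ] V} (h₁ : S₁ ∈ I.infExt V V)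
    (h₂ : S₂ ∈ I.infExt V V) : S₁ + S₂ ∈ I.infExt V V := by
  obtain ⟨E₁, F₁, _, _, _, _, _, _, A₁, R₁, Y₁, hR₁, rfl⟩ := h₁
  obtain ⟨E₂, F₂, _, _, _, _, _, _, A₂, R₂, Y₂, hR₂, rfl⟩ := h₂
  refine ⟨E₁ × E₂, F₁ × F₂, inferInstance, inferInstance, inferInstance, inferInstance,
    inferInstance, inferInstance, A₁.prod A₂,
    ((ContinuousLinearMap.inl ℂ F₁ F₂).comp R₁).comp (ContinuousLinearMap.fst ℂ E₁ E₂) +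
      ((ContinuousLinearMap.inr ℂ F₁ F₂).comp R₂).comp (ContinuousLinearMap.snd ℂ E₁ E₂),
    Y₁.coprod Y₂, Submodule.add_mem _ (I.ideal_mem _ _ _ hR₁) (I.ideal_mem _ _ _ hR₂), ?_⟩
  ext x
  simp

theorem sum_mem_infExt [IsTopologicalAddGroup V] {ι : Type*} (s : Finset ι) {S : ι → V →L[ℂ] V}
    (h : ∀ i ∈ s, S i ∈ I.infExt V V) : ∑ i ∈ s, S i ∈ I.infExt V V :=
  Finset.sum_induction S (· ∈ I.infExt V V) (fun _ _ => add_mem_infExt) zero_mem_infExt h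

variable [IsTopologicalAddGroup V] [ContinuousSMul ℂ V]

theorem hasAPLC_iff : I.HasAPLC V ↔ ∀ K : Set V, IsCompact K → ∀ W ∈ 𝓝 (0 : V),
    ∃ S ∈ I.infExt V V, ∀ x ∈ K, S x - x ∈ W :=
  closure_ofFun_image_eq_univ_iff fun T _ hS => comp_mem_infExt T hS

/-- A Banach space which is complemented in a locally convex space with the `I`-approximation
property has the `I`-approximation property. -/
theorem HasAPLC.hasAP_of_retract {X : Type u} [NormedAddCommGroup X] [NormedSpace ℂ X]
    [CompleteSpace X] (h : I.HasAPLC V) (i : X →L[ℂ] V) (p : V →L[ℂ] X)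
    (hpi : ∀ x, p (i x) = x) : I.HasAP X := by
  rw [hasAPLC_iff] at h
  rw [hasAP_iff]
  intro K hK ε hε
  obtain ⟨S, ⟨E, F, _, _, _, _, _, _, A, T, Y, hT, rfl⟩, hSK⟩ := h (i '' K)
    (hK.image i.continuous) (p ⁻¹' Metric.ball 0 ε)
    (p.continuous.continuousAt.preimage_mem_nhds (by simpa using Metric.ball_mem_nhds 0 hε))
  refine ⟨((p.comp Y).comp T).comp (A.comp i), I.ideal_mem _ _ _ hT, fun x hx => ?_⟩
  have h1 := hSK (i x) (mem_image_of_mem _ hx)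
  simpa [hpi] using h1

end LocallyConvex

end OperatorIdeal

/-! ### Reflexive spaces -/

/-- **Hahn-Banach theorem**: a point outside the closure of a subspace is separated from the
subspace by a continuous linear functional. -/
theorem exists_dual_eq_zero_of_notMem_closure {X : Type*} [NormedAddCommGroup X]
    [NormedSpace ℂ X] (M : Submodule ℂ X) {x : X} (hx : x ∉ closure (M : Set X)) :
    ∃ f : StrongDual ℂ X, (∀ m ∈ M, f m = 0) ∧ f x ≠ 0 := by
  let N := M.topologicalClosure
  have : IsClosed (N : Set X) := M.isClosed_topologicalClosure
  have hne : N.mkQL x ≠ 0 := by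
    intro h0
    exact hx ((Submodule.Quotient.mk_eq_zero N).1 h0)
  obtain ⟨g, hg⟩ := SeparatingDual.exists_ne_zero (R := ℂ) hne
  refine ⟨g.comp N.mkQL, fun m hm => ?_, hg⟩
  have : N.mkQL m = 0 := (Submodule.Quotient.mk_eq_zero N).2 (subset_closure hm)
  simp [this]


/-- An operator whose range lies in an isometric copy of `G` factors through `G`. -/
theorem LinearIsometry.exists_comp_eq_of_range_le {X G H : Type*} [NormedAddCommGroup X]
    [NormedSpace ℂ X] [NormedAddCommGroup G] [NormedSpace ℂ G] [NormedAddCommGroup H]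
    [NormedSpace ℂ H] (J : G →ₗᵢ[ℂ] H) (W : X →L[ℂ] H) (hW : ∀ x, ∃ g, J g = W x) :
    ∃ L : X →L[ℂ] G, ∀ x, J (L x) = W x := by
  choose g hg using hW
  refine ⟨LinearMap.mkContinuous
    { toFun := g
      map_add' := fun x y => J.injective (by simp [hg])
      map_smul' := fun c x => J.injective (by simp [hg]) } ‖W‖ fun x => ?_, hg⟩
  rw [← J.norm_map]
  exact (congrArg norm (hg x)).trans_le (W.le_opNorm x)

namespace IsReflexiveSpace

variable {X Y : Type u} [NormedAddCommGroup X] [NormedSpace ℂ X]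
  [NormedAddCommGroup Y] [NormedSpace ℂ Y]

/-- The canonical isomorphism of a reflexive space with its bidual. -/
noncomputable def equivBidual (h : IsReflexiveSpace X) :
    X ≃ₗᵢ[ℂ] StrongDual ℂ (StrongDual ℂ X) :=
  LinearIsometryEquiv.ofSurjective (NormedSpace.inclusionInDoubleDualLi ℂ) h

theorem of_equiv (h : IsReflexiveSpace X) (e : X ≃L[ℂ] Y) : IsReflexiveSpace Y := by
  intro Φ
  obtain ⟨x, hx⟩ := h (Φ.comp (ContinuousLinearMap.precomp ℂ (e.symm : Y →L[ℂ] X)))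
  refine ⟨e x, ?_⟩
  ext φ
  have := congr($hx (φ.comp (e : X →L[ℂ] Y)))
  simp only [NormedSpace.dual_def, ContinuousLinearMap.comp_apply] at this
  rw [NormedSpace.dual_def]
  refine this.trans (congrArg Φ ?_)
  ext y
  simp

/-- A Banach space with a reflexive dual is reflexive: a functional on the bidual vanishing on
the space is the evaluation at an element of the dual, hence zero. -/
theorem of_strongDual [CompleteSpace X] (h : IsReflexiveSpace (StrongDual ℂ X)) :
    IsReflexiveSpace X := by
  let J := NormedSpace.inclusionInDoubleDualLi ℂ (E := X)
  have hclosed : IsClosed (LinearMap.range J.toLinearMap :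
      Set (StrongDual ℂ (StrongDual ℂ X))) := by
    have := J.isometry.isUniformInducing.isComplete_range.isClosed
    rw [LinearMap.coe_range]
    exact this
  intro Φ
  by_contra hΦ
  obtain ⟨f, hf, hfΦ⟩ := exists_dual_eq_zero_of_notMem_closure (LinearMap.range J.toLinearMap)
    (x := Φ) (by rw [hclosed.closure_eq]; exact fun ⟨x, hx⟩ => hΦ ⟨x, hx⟩)
  obtain ⟨φ, rfl⟩ := h f
  refine hfΦ ?_
  have hφ : φ = 0 := by
    ext x
    exact hf (J x) ⟨x, rfl⟩
  simp [hφ]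

theorem strongDual (h : IsReflexiveSpace X) : IsReflexiveSpace (StrongDual ℂ X) := by
  intro F
  refine ⟨F.comp (NormedSpace.inclusionInDoubleDual ℂ X), ?_⟩
  ext Φ
  obtain ⟨x, rfl⟩ := h Φ
  rfl

end IsReflexiveSpace

/-- On a reflexive space, each of the inclusions `I ⊆ I^dual` and `I^dual ⊆ I` lets one recover
`S ∈ I` from `S' ∈ I`. -/
theorem OperatorIdeal.mem_of_precomp_mem {I : OperatorIdeal.{u}} (hdual : I.LeDual ∨ I.DualLe)
    {X : Type u} [NormedAddCommGroup X] [NormedSpace ℂ X] [CompleteSpace X]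
    (hX : IsReflexiveSpace X) (S : X →L[ℂ] X)
    (hS : (ContinuousLinearMap.precomp ℂ S : StrongDual ℂ X →L[ℂ] StrongDual ℂ X) ∈
      I.comp (StrongDual ℂ X) (StrongDual ℂ X)) : S ∈ I.comp X X := by
  rcases hdual with h | h
  · have h2 := I.ideal_mem (hX.equivBidual.symm.toContinuousLinearEquiv : _ →L[ℂ] X) _
      (hX.equivBidual.toContinuousLinearEquiv : X →L[ℂ] _) (h _ _ hS)
    convert h2 using 1
    ext x
    change S x = hX.equivBidual.symm (ContinuousLinearMap.precomp ℂ _ (hX.equivBidual x))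
    rw [LinearIsometryEquiv.eq_symm_apply]
    rfl
  · exact h _ _ hS

/-! ### Summable families -/

/-- A summable sequence of nonnegative numbers remains summable after division by a suitable
positive null sequence. -/
theorem Summable.exists_nat_tendsto_zero_summable_div {a : ℕ → ℝ} (ha : ∀ k, 0 ≤ a k)
    (hs : Summable a) : ∃ t : ℕ → ℝ, (∀ k, 0 < t k) ∧ Tendsto t atTop (𝓝 0) ∧
      Summable fun k => a k / t k := by
  -- The square roots of the tails of the series work; adding `(1 / 2) ^ k` makes them positive.
  set b : ℕ → ℝ := fun k => a k + (1 / 2) ^ k with hb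
  have hbpos : ∀ k, 0 < b k := fun k => add_pos_of_nonneg_of_pos (ha k) (by positivity)
  have hbs : Summable b := hs.add summable_geometric_two
  set r : ℕ → ℝ := fun k => ∑' j, b (j + k) with hr
  have hrs : ∀ k, Summable fun j => b (j + k) := fun k => (summable_nat_add_iff k).2 hbs
  have hrpos : ∀ k, 0 < r k := fun k =>
    (hrs k).tsum_pos (fun j => (hbpos _).le) 0 (hbpos _)
  have hrsucc : ∀ k, r k = b k + r (k + 1) := by
    intro k
    simp only [hr]
    rw [(hrs k).tsum_eq_zero_add]
    simp [add_assoc, add_comm 1 k]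
  refine ⟨fun k => √(r k), fun k => Real.sqrt_pos.2 (hrpos k), ?_, ?_⟩
  · have h := (tendsto_sum_nat_add b).sqrt
    simpa using h
  · have hle : ∀ k, a k / √(r k) ≤ 2 * (√(r k) - √(r (k + 1))) := by
      intro k
      have h1 : 0 < √(r k) := Real.sqrt_pos.2 (hrpos k)
      have h2 : √(r (k + 1)) ≤ √(r k) := Real.sqrt_le_sqrt (by
        rw [hrsucc k]; linarith [hbpos k])
      rw [div_le_iff₀ h1]
      have h3 : a k ≤ r k - r (k + 1) := by
        rw [hrsucc k]
        have : (0 : ℝ) < (1 / 2) ^ k := by positivity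
        simp only [hb]; linarith
      nlinarith [Real.sq_sqrt (hrpos k).le, Real.sq_sqrt (hrpos (k + 1)).le]
    refine summable_of_sum_range_le (c := 2 * √(r 0))
      (fun k => div_nonneg (ha k) (Real.sqrt_nonneg _)) fun n => ?_
    refine (Finset.sum_le_sum fun k _ => hle k).trans ?_
    rw [← Finset.mul_sum, Finset.sum_range_sub']
    linarith [Real.sqrt_nonneg (r n)]

theorem Summable.exists_tendsto_zero_summable_div {ι : Type*} {a : ι → ℝ} (ha : ∀ k, 0 ≤ a k)
    (hs : Summable a) : ∃ t : ι → ℝ, (∀ i, 0 ≤ t i) ∧ (∀ i, a i ≠ 0 → 0 < t i) ∧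
      Tendsto t cofinite (𝓝 0) ∧ Summable fun i => a i / t i := by
  classical
  obtain ⟨f, hf⟩ := countable_iff_exists_injOn.1 hs.countable_support
  let g : Function.support a → ℕ := fun i => f i
  have hg : Function.Injective g := injOn_iff_injective.1 hf
  let b : ℕ → ℝ := Function.extend g (fun i => a i) (fun _ => 0)
  have hbg : ∀ i : Function.support a, b (f i) = a i := fun i => hg.extend_apply _ _ i
  have hb' : ∀ k, k ∉ range g → b k = 0 := fun k hk => Function.extend_apply' _ _ _ hk
  have hb0 : ∀ k, 0 ≤ b k := by
    intro k
    by_cases hk : k ∈ range g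
    · obtain ⟨i, rfl⟩ := hk
      exact (ha i).trans_eq (hbg i).symm
    · exact (hb' k hk).ge
  have hbs : Summable b :=
    (hg.summable_iff hb').1 ((hs.subtype (Function.support a)).congr fun i => (hbg i).symm)
  obtain ⟨τ, hτpos, hτ0, hτs⟩ := hbs.exists_nat_tendsto_zero_summable_div hb0
  refine ⟨(Function.support a).indicator fun i => τ (f i),
    indicator_nonneg fun i _ => (hτpos _).le,
    fun i hi => by simpa [indicator_of_mem (show i ∈ Function.support a from hi)] using hτpos _,
    ?_, ?_⟩
  · rw [Metric.tendsto_nhds]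
    intro ε hε
    have h1 : ∀ᶠ k in cofinite, dist (τ k) 0 < ε :=
      Nat.cofinite_eq_atTop ▸ Metric.tendsto_nhds.1 hτ0 ε hε
    have h2 := (hg.tendsto_cofinite.eventually h1)
    rw [eventually_cofinite] at h2 ⊢
    refine (h2.image Subtype.val).subset fun i hi => ?_
    by_cases hia : i ∈ Function.support a
    · refine ⟨⟨i, hia⟩, ?_, rfl⟩
      simpa [indicator_of_mem hia] using hi
    · exact absurd hi (by simpa [indicator_of_notMem hia] using hε)
  · have hi : Function.Injective (Subtype.val : Function.support a → ι) := Subtype.val_injective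
    refine (hi.summable_iff fun i hia => ?_).1 ((hτs.comp_injective hg).congr fun i => ?_)
    · have : a i = 0 := by simpa using hia
      simp [this]
    · simp [g, hbg]

theorem summable_prod_mul_of_tsum_le {ι κ : Type*} {b : ι → κ → ℝ} {c q : ι → ℝ}
    (hb : ∀ i x, 0 ≤ b i x) (hq : ∀ i, 0 ≤ q i) (hbs : ∀ i, Summable (b i))
    (hbc : ∀ i, ∑' x, b i x ≤ 2 * c i) (hs : Summable fun i => c i * q i) :
    Summable fun p : ι × κ => b p.1 p.2 * q p.1 := by
  have h0 : ∀ p : ι × κ, 0 ≤ b p.1 p.2 * q p.1 := fun p => mul_nonneg (hb _ _) (hq _)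
  refine (summable_prod_of_nonneg h0).2 ⟨fun i => (hbs i).mul_right (q i), ?_⟩
  refine (hs.mul_left 2).of_nonneg_of_le (fun i => tsum_nonneg fun x => h0 (i, x)) fun i => ?_
  simp only [tsum_mul_right]
  rw [← mul_assoc]
  exact mul_le_mul_of_nonneg_right (hbc i) (hq i)

/-! ### Null families and compact sets -/

/-- Every compact set lies in the closed convex hull of twice a null family: its elements are
sums of series `∑ 2⁻ʲ x (s j)` whose terms are taken from the family `x`. -/
theorem IsCompact.exists_null_family {X : Type u} [NormedAddCommGroup X] [NormedSpace ℂ X]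
    {K : Set X} (hK : IsCompact K) :
    ∃ (ι : Type u) (x : ι → X), Tendsto x cofinite (𝓝 0) ∧ ∀ y ∈ K, ∃ s : ℕ → ι,
      Tendsto (fun n => ∑ j ∈ Finset.range n, ((1 / 2 : ℂ) ^ j) • x (s j)) atTop (𝓝 y) := by
  classical
  have hnet : ∀ (L : Set X) (δ : ℝ), ∃ F : Finset X, IsCompact L → 0 < δ →
      (∀ y ∈ F, y ∈ L) ∧ ∀ z ∈ L, ∃ y ∈ F, ‖z - y‖ < δ := by
    intro L δ
    by_cases h : IsCompact L ∧ 0 < δ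
    · obtain ⟨t, htL, htf, ht⟩ := h.1.finite_cover_balls h.2
      refine ⟨htf.toFinset, fun _ _ => ⟨fun y hy => htL (by simpa using hy), fun z hz => ?_⟩⟩
      obtain ⟨y, hy, hzy⟩ := mem_iUnion₂.1 (ht hz)
      exact ⟨y, by simpa using hy, by simpa [dist_eq_norm] using hzy⟩
    · exact ⟨∅, fun h1 h2 => absurd ⟨h1, h2⟩ h⟩
  choose net hnet using hnet
  -- `L (j + 1)` holds the doubled errors left after approximating the points of `L j` by a net.
  let δ : ℕ → ℝ := fun j => (1 / 2) ^ j
  have hδ : ∀ j, 0 < δ j := fun j => by positivity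
  let L : ℕ → Set X := fun j => Nat.rec K (fun j L =>
    (fun p : X × X => (2 : ℂ) • (p.1 - p.2)) '' (L ×ˢ (net L (δ j) : Set X)) ∩
      Metric.closedBall 0 (2 * δ j)) j
  have hLsucc : ∀ j, L (j + 1) =
      (fun p : X × X => (2 : ℂ) • (p.1 - p.2)) '' (L j ×ˢ (net (L j) (δ j) : Set X)) ∩
        Metric.closedBall 0 (2 * δ j) := fun j => rfl
  have hL : ∀ j, IsCompact (L j) := by
    intro j
    induction j with
    | zero => exact hK
    | succ j ih =>
      rw [hLsucc]
      exact ((ih.prod (Finset.finite_toSet _).isCompact).image (by fun_prop)).inter_right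
        Metric.isClosed_closedBall
  have hnorm : ∀ j, ∀ z ∈ L (j + 1), ‖z‖ ≤ 2 * δ j := by
    intro j z hz
    rw [hLsucc] at hz
    simpa using hz.2
  let ι := Σ j, {y // y ∈ net (L j) (δ j)}
  refine ⟨ι, fun i => i.2.1, ?_, fun y hy => ?_⟩
  · rw [Metric.tendsto_nhds]
    intro ε hε
    obtain ⟨N, hN⟩ := exists_pow_lt_of_lt_one (show 0 < ε / 2 by positivity)
      (show (1 / 2 : ℝ) < 1 by norm_num)
    rw [eventually_cofinite]
    have hfin : (⋃ j ∈ Finset.range (N + 1),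
        range fun y : {y // y ∈ net (L j) (δ j)} => (⟨j, y⟩ : ι)).Finite :=
      Set.Finite.biUnion (Finset.finite_toSet _) fun j _ => finite_range _
    refine hfin.subset ?_
    rintro ⟨j, y, hy⟩ hi
    simp only [mem_iUnion]
    refine ⟨j, ?_, ⟨y, hy⟩, rfl⟩
    by_contra hj
    simp only [Finset.mem_range, not_lt] at hj
    obtain ⟨k, rfl⟩ := Nat.exists_eq_add_of_le' (show 1 ≤ j by omega)
    refine hi ?_
    have h1 := hnorm k y ((hnet _ _ (hL (k + 1)) (hδ (k + 1))).1 y hy)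
    have h2 : δ k ≤ δ N := pow_le_pow_of_le_one (by norm_num) (by norm_num) (by omega)
    have h3 : δ N < ε / 2 := hN
    simp only [dist_zero_right]
    linarith
  · -- Follow the errors of the successive approximations of `y`.
    have hstep : ∀ j, ∀ z : L j, ∃ w : {w // w ∈ net (L j) (δ j)},
        (2 : ℂ) • (z.1 - w.1) ∈ L (j + 1) := by
      rintro j ⟨z, hz⟩
      obtain ⟨w, hw, hzw⟩ := (hnet _ _ (hL j) (hδ j)).2 z hz
      refine ⟨⟨w, hw⟩, ?_⟩
      rw [hLsucc]
      refine ⟨⟨(z, w), ⟨hz, hw⟩, rfl⟩, ?_⟩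
      simp only [mem_closedBall_zero_iff, norm_smul, Complex.norm_ofNat]
      linarith
    choose w hw using hstep
    let z : ∀ j, L j := fun j => Nat.rec ⟨y, hy⟩ (fun j z => ⟨_, hw j z⟩) j
    have hz : ∀ j, (z (j + 1)).1 = (2 : ℂ) • ((z j).1 - (w j (z j)).1) := fun j => rfl
    refine ⟨fun j => ⟨j, w j (z j)⟩, ?_⟩
    have hsum : ∀ n, ∑ j ∈ Finset.range n, ((1 / 2 : ℂ) ^ j) • (w j (z j)).1 =
        y - ((1 / 2 : ℂ) ^ n) • (z n).1 := by
      intro n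
      induction n with
      | zero => simp [z]
      | succ n ih =>
        rw [Finset.sum_range_succ, ih, hz, smul_smul, pow_succ]
        have : (1 / 2 : ℂ) ^ n * (1 / 2) * 2 = (1 / 2) ^ n := by ring
        rw [this, smul_sub]
        abel
    simp only [hsum]
    have hlim : Tendsto (fun n => ((1 / 2 : ℂ) ^ n) • (z n).1) atTop (𝓝 0) := by
      rw [← tendsto_add_atTop_iff_nat 1]
      refine squeeze_zero_norm (a := fun n => 2 * (1 / 2 : ℝ) ^ n) (fun n => ?_) ?_
      · rw [norm_smul]
        have h1 := hnorm n _ (z (n + 1)).2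
        have h2 : δ n ≤ 1 := pow_le_one₀ (by norm_num) (by norm_num)
        have h3 : ‖(1 / 2 : ℂ) ^ (n + 1)‖ = (1 / 2) ^ (n + 1) := by simp
        rw [h3, pow_succ]
        have h4 : (0 : ℝ) < (1 / 2) ^ n := by positivity
        nlinarith
      · simpa using (tendsto_pow_atTop_nhds_zero_of_lt_one (by norm_num)
          (show (1 / 2 : ℝ) < 1 by norm_num)).const_mul 2
    simpa using tendsto_const_nhds.sub hlim

/-- A continuous linear functional on `ℓ^∞(ι; X)` is given, on the families tending to `0`, by an
absolutely summable family of functionals on `X`. -/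
theorem lp.exists_dual_hasSum_of_tendsto_zero {ι : Type*} {X : Type*} [NormedAddCommGroup X]
    [NormedSpace ℂ X] (f : StrongDual ℂ (lp (fun _ : ι => X) ⊤)) :
    ∃ φ : ι → StrongDual ℂ X, (Summable fun i => ‖φ i‖) ∧
      ∀ y : lp (fun _ : ι => X) ⊤, Tendsto y cofinite (𝓝 0) →
        HasSum (fun i => φ i (y i)) (f y) := by
  classical
  let φ : ι → StrongDual ℂ X := fun i =>
    f.comp (lp.singleContinuousLinearMap ℂ (fun _ : ι => X) ⊤ i)
  have hφ : ∀ i x, φ i x = f (lp.single ⊤ i x) := fun _ _ => rfl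
  have hsum : ∀ (s : Finset ι) (v : ι → X) (j : ι),
      (∑ i ∈ s, lp.single (E := fun _ : ι => X) ⊤ i (v i) : lp (fun _ : ι => X) ⊤) j =
        if j ∈ s then v j else 0 := by
    intro s v j
    rw [lp.coeFn_sum, Finset.sum_apply]
    simp [lp.single_apply, Pi.single_apply]
  refine ⟨φ, ?_, fun y hy => ?_⟩
  · -- Almost norming vectors, rotated so that the values of `φ i` at them are nonnegative.
    have hv : ∀ i, ∃ v : X, ‖v‖ ≤ 1 ∧ ‖φ i‖ ≤ 2 * ‖φ i v‖ := by
      intro i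
      rcases eq_or_ne (φ i) 0 with h0 | h0
      · exact ⟨0, by simp, by simp [h0]⟩
      · obtain ⟨v, hv, hlt⟩ := (φ i).exists_lt_apply_of_lt_opNorm
          (half_lt_self (norm_pos_iff.2 h0))
        exact ⟨v, hv.le, by linarith⟩
    choose v hv1 hv2 using hv
    have hw : ∀ i, ∃ w : X, ‖w‖ ≤ 1 ∧ φ i w = (‖φ i (v i)‖ : ℂ) := by
      intro i
      rcases eq_or_ne (φ i (v i)) 0 with h0 | h0
      · exact ⟨0, by simp, by simp [h0]⟩
      · refine ⟨((‖φ i (v i)‖ : ℂ) / φ i (v i)) • v i, ?_, ?_⟩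
        · rw [norm_smul, norm_div, Complex.norm_real, norm_norm,
            div_self (norm_ne_zero_iff.2 h0), one_mul]
          exact hv1 i
        · rw [map_smul, smul_eq_mul, div_mul_cancel₀ _ h0]
    choose w hw1 hw2 using hw
    refine summable_of_sum_le (c := 2 * ‖f‖) (fun i => norm_nonneg _) fun s => ?_
    calc ∑ i ∈ s, ‖φ i‖ ≤ ∑ i ∈ s, 2 * ‖φ i (v i)‖ := Finset.sum_le_sum fun i _ => hv2 i
      _ = 2 * ∑ i ∈ s, ‖φ i (v i)‖ := by rw [Finset.mul_sum]
      _ ≤ 2 * ‖f‖ := by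
        gcongr
        have h1 : ((∑ i ∈ s, ‖φ i (v i)‖ : ℝ) : ℂ) = f (∑ i ∈ s, lp.single ⊤ i (w i)) := by
          rw [map_sum]
          push_cast
          exact Finset.sum_congr rfl fun i _ => by rw [← hw2, hφ]
        have h2 : ‖(∑ i ∈ s, lp.single (E := fun _ : ι => X) ⊤ i (w i))‖ ≤ 1 := by
          refine lp.norm_le_of_forall_le zero_le_one fun j => ?_
          rw [hsum]
          split_ifs
          · exact hw1 j
          · simp
        calc ∑ i ∈ s, ‖φ i (v i)‖ ≤ ‖((∑ i ∈ s, ‖φ i (v i)‖ : ℝ) : ℂ)‖ := by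
              rw [Complex.norm_real]; exact le_abs_self _
          _ ≤ ‖f‖ := by rw [h1]; exact f.unit_le_opNorm _ h2
  · have hlim : Tendsto (fun s : Finset ι => ∑ i ∈ s, lp.single (E := fun _ : ι => X) ⊤ i (y i))
        atTop (𝓝 y) := by
      rw [Metric.tendsto_atTop]
      intro ε hε
      have hfin := Metric.tendsto_nhds.1 hy (ε / 2) (by positivity)
      rw [eventually_cofinite] at hfin
      refine ⟨hfin.toFinset, fun s hs => ?_⟩
      rw [dist_eq_norm]
      refine (lp.norm_le_of_forall_le (C := ε / 2) (by positivity) fun j => ?_).trans_lt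
        (by linarith)
      rw [lp.coeFn_sub, Pi.sub_apply, hsum]
      split_ifs with hj
      · simp; positivity
      · have : j ∉ hfin.toFinset := fun h => hj (hs h)
        simp only [Finite.mem_toFinset, mem_ofPred_eq, not_not, dist_zero_right] at this
        simpa using this.le
    have h2 := (f.continuous.tendsto y).comp hlim
    refine h2.congr fun s => ?_
    simp [hφ]

/-! ### Grothendieck's criterion -/

/-- **Grothendieck's criterion**: a subspace of operators approximates the identity on compact sets
if every trace form `R ↦ ∑ φᵢ (R xᵢ)` that vanishes on it vanishes at the identity. -/
theorem exists_approx_id_of_trace {X : Type u} [NormedAddCommGroup X] [NormedSpace ℂ X]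
    (M : Submodule ℂ (X →L[ℂ] X))
    (hM : ∀ (ι : Type u) (φ : ι → StrongDual ℂ X) (x : ι → X),
      (Summable fun i => ‖φ i‖ * ‖x i‖) → (∀ R ∈ M, ∑' i, φ i (R (x i)) = 0) →
        ∑' i, φ i (x i) = 0)
    {K : Set X} (hK : IsCompact K) {ε : ℝ} (hε : 0 < ε) :
    ∃ R ∈ M, ∀ y ∈ K, ‖R y - y‖ < ε := by
  obtain ⟨ι, x, hx, hxK⟩ := hK.exists_null_family
  obtain ⟨C, hC⟩ : ∃ C, ∀ i, ‖x i‖ ≤ C := by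
    have h1 := (hx.isCompact_insert_range_of_cofinite).isBounded
    obtain ⟨C, hC⟩ := h1.exists_norm_le
    exact ⟨C, fun i => hC _ (mem_insert_of_mem _ ⟨i, rfl⟩)⟩
  have hmem : ∀ R : X →L[ℂ] X, Memℓp (fun i => R (x i)) ⊤ := by
    intro R
    refine memℓp_infty ⟨‖R‖ * C, ?_⟩
    rintro _ ⟨i, rfl⟩
    exact (R.le_opNorm _).trans (by gcongr; exact hC i)
  -- Evaluation along the null family, as a map into `ℓ^∞(ι; X)`.
  let ev : (X →L[ℂ] X) →ₗ[ℂ] lp (fun _ : ι => X) ⊤ :=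
    { toFun := fun R => ⟨fun i => R (x i), hmem R⟩
      map_add' := fun R S => by ext; rfl
      map_smul' := fun c R => by ext; rfl }
  have hev : ∀ R i, ev R i = R (x i) := fun _ _ => rfl
  have hev0 : ∀ R, Tendsto (ev R) cofinite (𝓝 0) := fun R => by
    have h1 := (R.continuous.tendsto 0).comp hx
    rwa [map_zero] at h1
  have hcl : ev (ContinuousLinearMap.id ℂ X) ∈
      closure (M.map ev : Set (lp (fun _ : ι => X) ⊤)) := by
    by_contra hnot
    obtain ⟨f, hf0, hf⟩ := exists_dual_eq_zero_of_notMem_closure _ hnot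
    obtain ⟨φ, hφs, hφ⟩ := lp.exists_dual_hasSum_of_tendsto_zero f
    refine hf ?_
    rw [← (hφ _ (hev0 _)).tsum_eq]
    refine hM ι φ x ?_ fun R hR => ?_
    · exact (hφs.mul_right C).of_nonneg_of_le (fun i => by positivity)
        fun i => by gcongr; exact hC i
    · rw [← hf0 (ev R) ⟨R, hR, rfl⟩, ← (hφ _ (hev0 _)).tsum_eq]
      rfl
  obtain ⟨_, ⟨R, hR, rfl⟩, hRε⟩ := Metric.mem_closure_iff.1 hcl (ε / 3) (by positivity)
  refine ⟨R, hR, fun y hy => ?_⟩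
  have hbd : ∀ i, ‖R (x i) - x i‖ ≤ ε / 3 := by
    intro i
    have h1 := lp.norm_apply_le_norm ENNReal.top_ne_zero
      (ev (ContinuousLinearMap.id ℂ X) - ev R) i
    rw [dist_eq_norm] at hRε
    have h2 : (ev (ContinuousLinearMap.id ℂ X) - ev R) i = -(R (x i) - x i) := by
      rw [lp.coeFn_sub, Pi.sub_apply, hev, hev]; simp
    rw [h2, norm_neg] at h1
    linarith
  obtain ⟨s, hs⟩ := hxK y hy
  let D : X →L[ℂ] X := R - ContinuousLinearMap.id ℂ X
  have hD : ∀ z, D z = R z - z := fun _ => rfl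
  have hlim := ((D.continuous.tendsto y).comp hs).norm
  have hle : ‖D y‖ ≤ 2 * (ε / 3) := by
    refine le_of_tendsto hlim (Eventually.of_forall fun n => ?_)
    simp only [Function.comp_apply, map_sum, map_smul]
    refine (norm_sum_le _ _).trans ?_
    calc ∑ j ∈ Finset.range n, ‖((1 / 2 : ℂ) ^ j) • D (x (s j))‖
        ≤ ∑ j ∈ Finset.range n, (1 / 2 : ℝ) ^ j * (ε / 3) := by
          refine Finset.sum_le_sum fun j _ => ?_
          rw [norm_smul]
          have : ‖(1 / 2 : ℂ) ^ j‖ = (1 / 2) ^ j := by simp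
          rw [this, hD]
          gcongr
          exact hbd _
      _ = (∑ j ∈ Finset.range n, (1 / 2 : ℝ) ^ j) * (ε / 3) := by rw [Finset.sum_mul]
      _ ≤ 2 * (ε / 3) := by gcongr; exact sum_geometric_two_le n
  rw [← hD]
  linarith

/-! ### Norming sets and absolutely convergent expansions -/

/-- If the vectors `d i` of the unit ball are norming for the dual, then every vector is the sum of
an absolutely convergent series `∑ uᵢ dᵢ`. This is the surjectivity of the quotient map from `ℓ¹`:
by the Hahn-Banach theorem the image of the unit ball is dense in the unit ball, and successive
approximation does the rest. -/
theorem exists_hasSum_smul_of_norming {D X : Type*} [NormedAddCommGroup X] [NormedSpace ℂ X]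
    [CompleteSpace X] (d : D → X) (hd : ∀ i, ‖d i‖ ≤ 1)
    (hnorming : ∀ (φ : StrongDual ℂ X) (C : ℝ), 0 ≤ C → (∀ i, ‖φ (d i)‖ ≤ C) → ‖φ‖ ≤ C) (y : X) :
    ∃ u : D → ℂ, (Summable fun i => ‖u i‖) ∧ ∑' i, ‖u i‖ ≤ 2 * ‖y‖ ∧
      HasSum (fun i => u i • d i) y := by
  classical
  have hone : (0 : ℝ) < (1 : ENNReal).toReal := by simp
  have hsummable : ∀ u : lp (fun _ : D => ℂ) 1, Summable fun i => ‖u i‖ := fun u => by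
    simpa using (lp.memℓp u).summable hone
  have hnorm : ∀ u : lp (fun _ : D => ℂ) 1, ‖u‖ = ∑' i, ‖u i‖ := fun u => by
    simpa using lp.norm_eq_tsum_rpow hone u
  have hterm : ∀ (u : lp (fun _ : D => ℂ) 1) i, ‖u i • d i‖ ≤ ‖u i‖ := fun u i => by
    rw [norm_smul]; exact mul_le_of_le_one_right (norm_nonneg _) (hd i)
  have hs : ∀ u : lp (fun _ : D => ℂ) 1, Summable fun i => u i • d i := fun u =>
    .of_norm_bounded (hsummable u) (hterm u)
  let L : lp (fun _ : D => ℂ) 1 →L[ℂ] X := LinearMap.mkContinuous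
    { toFun := fun u => ∑' i, u i • d i
      map_add' := fun u v => by
        rw [← (hs u).tsum_add (hs v)]
        exact tsum_congr fun i => by simp [add_smul]
      map_smul' := fun c u => by
        rw [RingHom.id_apply, ← (hs u).tsum_const_smul]
        exact tsum_congr fun i => by simp [mul_smul] } 1 fun u => by
    rw [one_mul, hnorm]
    exact tsum_of_norm_bounded (hsummable u).hasSum (hterm u)
  have hL : ∀ u, L u = ∑' i, u i • d i := fun _ => rfl
  have hLsingle : ∀ i (c : ℂ), L (lp.single 1 i c) = c • d i := by
    intro i c
    rw [hL, tsum_eq_single i fun j hj => by simp [Pi.single_eq_of_ne hj]]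
    simp
  have hball : ∀ z : X, ‖z‖ ≤ 1 → z ∈ closure (L '' Metric.closedBall 0 1) := by
    intro z hz
    by_contra hnot
    obtain ⟨f, s, hfs, hfz⟩ := RCLike.geometric_hahn_banach_closed_point (𝕜 := ℂ)
      (((convex_closedBall (0 : lp (fun _ : D => ℂ) 1) 1).is_linear_image
        (L.toLinearMap.restrictScalars ℝ).isLinear).closure) isClosed_closure hnot
    have hfs' : ∀ u : lp (fun _ : D => ℂ) 1, ‖u‖ ≤ 1 → (f (L u)).re < s := fun u hu =>
      hfs _ (subset_closure ⟨u, by simpa using hu, rfl⟩)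
    have hs0 : 0 < s := by simpa using hfs' 0 (by simp)
    have hle : ‖f‖ ≤ s := by
      refine hnorming f s hs0.le fun i => ?_
      rcases eq_or_ne (f (d i)) 0 with h0 | h0
      · simpa [h0] using hs0.le
      have hc : ‖(‖f (d i)‖ : ℂ) / f (d i)‖ = 1 := by
        rw [norm_div, Complex.norm_real, norm_norm, div_self (norm_ne_zero_iff.2 h0)]
      have h1 := hfs' (lp.single 1 i ((‖f (d i)‖ : ℂ) / f (d i)))
        (by rw [lp.norm_single (by simp), hc])
      rw [hLsingle, map_smul, smul_eq_mul, div_mul_cancel₀ _ h0, Complex.ofReal_re] at h1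
      exact h1.le
    have h2 : (f z).re ≤ s := (Complex.re_le_norm _).trans
      ((f.le_opNorm z).trans (by nlinarith [norm_nonneg f, norm_nonneg z]))
    have h3 : s < (f z).re := hfz
    linarith
  have happrox : ∀ z : X, ∃ u : lp (fun _ : D => ℂ) 1, ‖u‖ ≤ ‖z‖ ∧ ‖z - L u‖ ≤ ‖z‖ / 2 := by
    intro z
    rcases eq_or_ne z 0 with rfl | hz
    · exact ⟨0, by simp, by simp⟩
    have hz' : 0 < ‖z‖ := norm_pos_iff.2 hz
    have hzc : (‖z‖ : ℂ) ≠ 0 := by exact_mod_cast hz'.ne'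
    obtain ⟨_, ⟨u, hu, rfl⟩, hzu⟩ := Metric.mem_closure_iff.1
      (hball ((‖z‖ : ℂ)⁻¹ • z) (by simp [norm_smul, hz'.ne'])) (1 / 2) (by norm_num)
    refine ⟨(‖z‖ : ℂ) • u, ?_, ?_⟩
    · rw [norm_smul]
      have : ‖u‖ ≤ 1 := by simpa using hu
      simpa using mul_le_of_le_one_right hz'.le this
    · have h1 : z - L ((‖z‖ : ℂ) • u) = (‖z‖ : ℂ) • ((‖z‖ : ℂ)⁻¹ • z - L u) := by
        rw [smul_sub, smul_smul, mul_inv_cancel₀ hzc, one_smul, map_smul]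
      rw [h1, norm_smul, Complex.norm_real, norm_norm]
      rw [dist_eq_norm] at hzu
      nlinarith
  choose g hg1 hg2 using happrox
  let z : ℕ → X := fun n => Nat.rec y (fun _ z => z - L (g z)) n
  have hz : ∀ n, z (n + 1) = z n - L (g (z n)) := fun _ => rfl
  have hzn : ∀ n, ‖z n‖ ≤ ‖y‖ * (1 / 2) ^ n := by
    intro n
    induction n with
    | zero => simp [z]
    | succ n ih =>
      rw [hz, pow_succ]
      refine (hg2 _).trans ?_
      linarith
  have hgs : HasSum (fun n => ‖y‖ * (1 / 2 : ℝ) ^ n) (‖y‖ * 2) := hasSum_geometric_two.mul_left _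
  have hgn : ∀ n, ‖g (z n)‖ ≤ ‖y‖ * (1 / 2) ^ n := fun n => (hg1 _).trans (hzn n)
  have hgsum : Summable fun n => g (z n) := .of_norm_bounded hgs.summable hgn
  let u := ∑' n, g (z n)
  refine ⟨u, hsummable u, ?_, ?_⟩
  · rw [← hnorm, mul_comm]
    exact tsum_of_norm_bounded hgs hgn
  · have hLu : L u = y := by
      have h1 : HasSum (fun n => L (g (z n))) (L u) := hgsum.hasSum.mapL L
      have h2 : ∀ n, ∑ k ∈ Finset.range n, L (g (z k)) = y - z n := by
        intro n
        induction n with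
        | zero => simp [z]
        | succ n ih => rw [Finset.sum_range_succ, ih, hz]; abel
      have h3 := h1.tendsto_sum_nat
      simp only [h2] at h3
      have h4 : Tendsto z atTop (𝓝 0) := squeeze_zero_norm hzn (by
        simpa using (tendsto_pow_atTop_nhds_zero_of_lt_one (by norm_num)
          (show (1 / 2 : ℝ) < 1 by norm_num)).const_mul ‖y‖)
      exact tendsto_nhds_unique h3 (by simpa using tendsto_const_nhds.sub h4)
    rw [← hLu, hL]
    exact (hs u).hasSum

/-! ### Homogeneous polynomials and the dual of their space -/

namespace HomPoly

variable {n : ℕ} {E F : Type u} [NormedAddCommGroup E] [NormedSpace ℂ E]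
  [NormedAddCommGroup F] [NormedSpace ℂ F]

/-- Composition with a continuous linear map on the right, `P ↦ P ∘ T`. -/
noncomputable def compRight (n : ℕ) (T : E →L[ℂ] F) : HomPoly n F →L[ℂ] HomPoly n E :=
  LinearMap.mkContinuous
    { toFun := fun P => ⟨fun x => P (T x), by
        obtain ⟨A, hA⟩ := P.2
        exact ⟨A.compContinuousLinearMap fun _ => T, fun x => hA (T x)⟩⟩
      map_add' := fun _ _ => rfl
      map_smul' := fun _ _ => rfl } (‖T‖ ^ n) fun P => by
    refine norm_le _ fun x hx => (P.apply_le (T x)).trans ?_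
    rw [mul_comm]
    gcongr
    exact (T.le_opNorm x).trans (mul_le_of_le_one_right (norm_nonneg _) hx)

@[simp] theorem compRight_apply (T : E →L[ℂ] F) (P : HomPoly n F) (x : E) :
    compRight n T P x = P (T x) := rfl

/-- Evaluation at a point, as a continuous linear functional on `P(ⁿE)`. -/
noncomputable def eval (n : ℕ) (x : E) : StrongDual ℂ (HomPoly n E) :=
  LinearMap.mkContinuous
    { toFun := fun P => P x
      map_add' := fun _ _ => rfl
      map_smul' := fun _ _ => rfl } (‖x‖ ^ n) fun P => by
    rw [mul_comm]; exact P.apply_le x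

@[simp] theorem eval_apply (x : E) (P : HomPoly n E) : eval n x P = P x := rfl

theorem norm_eval_le_one {x : E} (hx : ‖x‖ ≤ 1) : ‖eval n x‖ ≤ 1 :=
  (LinearMap.mkContinuous_norm_le _ (by positivity) _).trans (pow_le_one₀ (norm_nonneg _) hx)

@[simp] theorem sub_apply (P Q : HomPoly n E) (x : E) : (P - Q) x = P x - Q x := by
  simpa using (eval n x).map_sub P Q

/-- If `P(ⁿE)` is reflexive, its dual plays the part of the symmetric projective tensor power of
`E`: every functional is the sum of an absolutely convergent series of point evaluations. -/
theorem exists_hasSum_eval (h : IsReflexiveSpace (HomPoly n E))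
    (θ : StrongDual ℂ (HomPoly n E)) :
    ∃ u : {x : E // ‖x‖ ≤ 1} → ℂ, (Summable fun x => ‖u x‖) ∧ ∑' x, ‖u x‖ ≤ 2 * ‖θ‖ ∧
      HasSum (fun x => u x • eval n (x : E)) θ := by
  refine exists_hasSum_smul_of_norming (fun x : {x : E // ‖x‖ ≤ 1} => eval n (x : E))
    (fun x => norm_eval_le_one x.2) (fun Φ C hC hΦ => ?_) θ
  obtain ⟨P, rfl⟩ := h.equivBidual.surjective Φ
  rw [LinearIsometryEquiv.norm_map]
  exact P.norm_le fun x hx => hΦ ⟨x, hx⟩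

theorem hasSum_eval_apply {ι : Type*} {u : ι → ℂ} {x : ι → E} {θ : StrongDual ℂ (HomPoly n E)}
    (h : HasSum (fun i => u i • eval n (x i)) θ) (P : HomPoly n E) :
    HasSum (fun i => u i * P (x i)) (θ P) := by
  simpa using h.mapL (ContinuousLinearMap.apply ℂ ℂ P)

theorem eq_of_eqOn_eval (h : IsReflexiveSpace (HomPoly n E)) {G : Type*}
    [NormedAddCommGroup G] [NormedSpace ℂ G] {R S : StrongDual ℂ (HomPoly n E) →L[ℂ] G}
    (hRS : ∀ x : E, R (eval n x) = S (eval n x)) : R = S := by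
  ext θ
  obtain ⟨u, -, -, hu⟩ := exists_hasSum_eval h θ
  have h1 := hu.mapL R
  have h2 := hu.mapL S
  simp only [map_smul, hRS] at h1 h2
  exact h1.unique h2

theorem exists_lipschitz (n : ℕ) (E : Type u) [NormedAddCommGroup E] [NormedSpace ℂ E] {R : ℝ}
    (hR : 0 ≤ R) : ∃ C, 0 ≤ C ∧ ∀ (P : HomPoly n E) (x y : E), ‖x‖ ≤ R → ‖y‖ ≤ R →
      ‖P x - P y‖ ≤ C * ‖P‖ * ‖x - y‖ := by
  obtain ⟨C, hC⟩ := exists_bound n E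
  refine ⟨|C| * (n * R ^ (n - 1)), by positivity, fun P x y hx hy => ?_⟩
  obtain ⟨B, rfl, hB⟩ := hC P
  have hB' : ‖B‖ ≤ |C| * ‖diag n E B‖ := hB.trans (by gcongr; exact le_abs_self C)
  have h1 := B.norm_image_sub_le (fun _ => x) (fun _ => y)
  have hx' : ‖(fun _ : Fin n => x)‖ ≤ R := (pi_norm_le_iff_of_nonneg hR).2 fun _ => hx
  have hy' : ‖(fun _ : Fin n => y)‖ ≤ R := (pi_norm_le_iff_of_nonneg hR).2 fun _ => hy
  have hxy : ‖(fun _ : Fin n => x) - fun _ => y‖ ≤ ‖x - y‖ :=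
    (pi_norm_le_iff_of_nonneg (norm_nonneg _)).2 fun _ => le_rfl
  rw [diag_apply, diag_apply]
  refine h1.trans ?_
  rw [Fintype.card_fin]
  calc ‖B‖ * n * max ‖(fun _ : Fin n => x)‖ ‖(fun _ : Fin n => y)‖ ^ (n - 1) *
        ‖(fun _ : Fin n => x) - fun _ => y‖
      ≤ (|C| * ‖diag n E B‖) * n * R ^ (n - 1) * ‖x - y‖ := by
        gcongr
        exact max_le hx' hy'
    _ = |C| * (n * R ^ (n - 1)) * ‖diag n E B‖ * ‖x - y‖ := by ring

/-- The functional `P ↦ P̌(x₁, …, xₙ)`, where `P̌` is the symmetric `n`-linear form of `P`, given by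
the polarization formula. -/
noncomputable def polarEval (x : Fin n → E) : StrongDual ℂ (HomPoly n E) :=
  (2 ^ n * (n.factorial : ℂ))⁻¹ • ∑ ε : Fin n → ℤˣ, ((∏ i, (ε i : ℤ) : ℤ) : ℂ) •
    eval n (∑ i, (((ε i : ℤ) : ℂ)) • x i)

theorem polarEval_diag (A : ContinuousMultilinearMap ℂ (fun _ : Fin n => E) ℂ) (x : Fin n → E) :
    polarEval x (diag n E A) =
      ((n.factorial : ℂ)⁻¹ • ∑ σ : Equiv.Perm (Fin n), A.domDomCongr σ) x := by
  have h := polarization A x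
  have hfac : (n.factorial : ℂ) ≠ 0 := by exact_mod_cast n.factorial_ne_zero
  simp only [polarEval, _root_.smul_apply, sum_apply, eval_apply,
    diag_apply, smul_eq_mul, ContinuousMultilinearMap.domDomCongr_apply]
  rw [h]
  field_simp

theorem exists_diag_eq (P : HomPoly n E) : ∃ A, diag n E A = P := by
  obtain ⟨A, hA⟩ := P.2
  exact ⟨A, ext fun x => (hA x).symm⟩

theorem polarEval_const (x : E) : polarEval (fun _ : Fin n => x) = eval n x := by
  ext P
  obtain ⟨A, rfl⟩ := exists_diag_eq P
  have hfac : (n.factorial : ℂ) ≠ 0 := by exact_mod_cast n.factorial_ne_zero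
  rw [polarEval_diag]
  simp [diag_apply, Fintype.card_perm, hfac]

/-- The `n`-linear map `(x₁, …, xₙ) ↦ (P ↦ P̌(x₁, …, xₙ))` into the dual of `P(ⁿE)`, which stands
for the symmetric tensor product of vectors. -/
noncomputable def polarMap (n : ℕ) (E : Type u) [NormedAddCommGroup E] [NormedSpace ℂ E] :
    ContinuousMultilinearMap ℂ (fun _ : Fin n => E) (StrongDual ℂ (HomPoly n E)) :=
  MultilinearMap.mkContinuous
    { toFun := polarEval
      map_update_add' := fun x i y z => by
        ext P
        obtain ⟨A, rfl⟩ := exists_diag_eq P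
        rw [_root_.add_apply]
        simp only [polarEval_diag]
        exact ContinuousMultilinearMap.map_update_add _ x i y z
      map_update_smul' := fun x i c y => by
        ext P
        obtain ⟨A, rfl⟩ := exists_diag_eq P
        rw [_root_.smul_apply]
        simp only [polarEval_diag]
        exact ContinuousMultilinearMap.map_update_smul _ x i c y }
    (|(exists_bound n E).choose|) fun x => by
      refine ContinuousLinearMap.opNorm_le_bound _ (by positivity) fun P => ?_
      obtain ⟨B, hBP, hB⟩ := (exists_bound n E).choose_spec P
      have hfac : (n.factorial : ℝ) ≠ 0 := by exact_mod_cast n.factorial_ne_zero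
      have h1 : ∀ σ : Equiv.Perm (Fin n), ‖B.domDomCongr σ x‖ ≤ ‖B‖ * ∏ i, ‖x i‖ := by
        intro σ
        rw [ContinuousMultilinearMap.domDomCongr_apply]
        refine (B.le_opNorm _).trans_eq ?_
        rw [Equiv.prod_comp σ fun i => ‖x i‖]
      have h2 : ‖polarEval x P‖ ≤ ‖B‖ * ∏ i, ‖x i‖ := by
        rw [← hBP, polarEval_diag, _root_.smul_apply, norm_smul,
          sum_apply]
        have h3 := norm_sum_le_of_le Finset.univ fun σ _ => h1 σ
        rw [Finset.sum_const, Finset.card_univ, Fintype.card_perm, Fintype.card_fin,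
          nsmul_eq_mul] at h3
        rw [norm_inv, Complex.norm_natCast, inv_mul_le_iff₀ (by positivity)]
        exact h3
      calc ‖polarEval x P‖ ≤ ‖B‖ * ∏ i, ‖x i‖ := h2
        _ ≤ (|(exists_bound n E).choose| * ‖P‖) * ∏ i, ‖x i‖ := by
          gcongr
          exact hB.trans (by gcongr; exact le_abs_self _)
        _ = _ := by ring

@[simp] theorem polarMap_const (x : E) : polarMap n E (fun _ => x) = eval n x :=
  polarEval_const x

/-- Universal property of the dual of a reflexive `P(ⁿE)`: a continuous `n`-linear map factors on
the diagonal through the evaluation functionals. -/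
theorem exists_linearization (h : IsReflexiveSpace (HomPoly n E)) {G : Type u}
    [NormedAddCommGroup G] [NormedSpace ℂ G] [CompleteSpace G]
    (B : ContinuousMultilinearMap ℂ (fun _ : Fin n => E) G) :
    ∃ L : StrongDual ℂ (HomPoly n E) →L[ℂ] G, ∀ x : E, L (eval n x) = B fun _ => x := by
  let J := NormedSpace.inclusionInDoubleDualLi ℂ (E := G)
  -- The adjoint of `ψ ↦ ψ ∘ B`, which takes its values in the bidual of `G`.
  let W : StrongDual ℂ (HomPoly n E) →L[ℂ] StrongDual ℂ (StrongDual ℂ G) :=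
    ContinuousLinearMap.precomp ℂ ((diag n E).comp
      ((ContinuousLinearMap.compContinuousMultilinearMapL ℂ (fun _ : Fin n => E) G ℂ).flip B))
  have hW : ∀ x : E, W (eval n x) = J (B fun _ => x) := fun x => rfl
  have hrange : ∀ θ, ∃ g, J g = W θ := by
    intro θ
    obtain ⟨u, hu, -, hθ⟩ := exists_hasSum_eval h θ
    have hs : Summable fun x : {x : E // ‖x‖ ≤ 1} => u x • B fun _ => (x : E) := by
      refine .of_norm_bounded (hu.mul_right ‖B‖) fun x => ?_
      rw [norm_smul]
      gcongr
      refine (B.le_opNorm _).trans (mul_le_of_le_one_right (norm_nonneg _) ?_)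
      simpa using pow_le_one₀ (norm_nonneg _) x.2
    refine ⟨∑' x : {x : E // ‖x‖ ≤ 1}, u x • B fun _ => (x : E), ?_⟩
    have h1 := hs.hasSum.mapL J.toContinuousLinearMap
    have h2 := hθ.mapL W
    simp only [map_smul, hW] at h1 h2
    exact h1.unique h2
  obtain ⟨L, hL⟩ := LinearIsometry.exists_comp_eq_of_range_le
    (X := StrongDual ℂ (HomPoly n E)) (H := StrongDual ℂ (StrongDual ℂ G)) J W hrange
  exact ⟨L, fun x => J.injective ((hL _).trans (hW x))⟩

end HomPoly

/-! ### The approximation property of spaces of polynomials -/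

namespace OperatorIdeal

variable {I : OperatorIdeal.{u}} {n : ℕ} {E : Type u} [NormedAddCommGroup E] [NormedSpace ℂ E]
  [CompleteSpace E]

/-- If `T ∈ I(E;E)`, then `P ↦ P ∘ T` belongs to `I`. Its adjoint maps the evaluation at `x` to the
evaluation at `T x`, so it linearizes a multilinear map of the class `L[I] ⊆ I ∘ L`; reflexivity
brings the membership in `I` back from the adjoint. -/
theorem compRight_mem (hI : I.FactorizationLeComposition) (hdual : I.LeDual ∨ I.DualLe)
    (hn : 1 ≤ n) (h : IsReflexiveSpace (HomPoly n E)) {T : E →L[ℂ] E} (hT : T ∈ I.comp E E) :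
    HomPoly.compRight n T ∈ I.comp (HomPoly n E) (HomPoly n E) := by
  refine mem_of_precomp_mem hdual h _ ?_
  obtain ⟨G, _, _, _, B, v, hv, hB⟩ := hI n hn (fun _ => E) (StrongDual ℂ (HomPoly n E))
    ⟨fun _ => E, fun _ => inferInstance, fun _ => inferInstance, fun _ => inferInstance,
      fun _ => T, HomPoly.polarMap n E, fun _ => hT, rfl⟩
  obtain ⟨L, hL⟩ := HomPoly.exists_linearization h B
  convert comp_mem_right hv L using 1
  refine HomPoly.eq_of_eqOn_eval h fun x => ?_
  have h1 := congr($hB fun _ => x)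
  simp only [ContinuousMultilinearMap.compContinuousLinearMap_apply,
    ContinuousLinearMap.compContinuousMultilinearMap_coe, Function.comp_apply,
    HomPoly.polarMap_const] at h1
  rw [ContinuousLinearMap.comp_apply, hL, ← h1]
  rfl

theorem HasAP.homPoly (hI : I.FactorizationLeComposition) (hdual : I.LeDual ∨ I.DualLe)
    (hn : 1 ≤ n) (h : IsReflexiveSpace (HomPoly n E)) (hE : I.HasAP E) :
    I.HasAP (HomPoly n E) := by
  rw [hasAP_iff] at hE ⊢
  intro K hK ε hε
  refine exists_approx_id_of_trace (I.comp _ _) (fun ι θ Q hs htr => ?_) hK hε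
  choose u hu hule hθ using fun i => HomPoly.exists_hasSum_eval h (θ i)
  -- Scale the points of evaluation to a null family at the cost of the coefficients.
  let a : ι × {x : E // ‖x‖ ≤ 1} → ℝ := fun p => ‖u p.1 p.2‖ * ‖Q p.1‖
  have ha : ∀ p, 0 ≤ a p := fun p => by positivity
  have has : Summable a :=
    summable_prod_mul_of_tsum_le (b := fun i x => ‖u i x‖) (c := fun i => ‖θ i‖)
      (q := fun i => ‖Q i‖) (fun _ _ => norm_nonneg _) (fun _ => norm_nonneg _) hu hule hs
  obtain ⟨t, ht0, htpos, htlim, hts⟩ := has.exists_tendsto_zero_summable_div ha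
  have hn' : (n : ℝ) ≠ 0 := by positivity
  let s : ι × {x : E // ‖x‖ ≤ 1} → ℝ := fun p => t p ^ (n⁻¹ : ℝ)
  have hs0 : ∀ p, 0 ≤ s p := fun p => Real.rpow_nonneg (ht0 p) _
  have hsn : ∀ p, s p ^ n = t p := fun p => Real.rpow_inv_natCast_pow (ht0 p) (by omega)
  have hslim : Tendsto s cofinite (𝓝 0) := by
    have h1 := htlim.rpow_const (p := (n⁻¹ : ℝ)) (Or.inr (by positivity))
    rwa [Real.zero_rpow (inv_ne_zero hn')] at h1
  let z : ι × {x : E // ‖x‖ ≤ 1} → E := fun p => (s p : ℂ) • (p.2 : E)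
  have hz : Tendsto z cofinite (𝓝 0) := by
    refine squeeze_zero_norm (fun p => ?_) hslim
    rw [norm_smul, Complex.norm_real, Real.norm_of_nonneg (hs0 p)]
    exact mul_le_of_le_one_right (hs0 p) p.2.2
  have hcomp := hz.isCompact_insert_range_of_cofinite
  obtain ⟨R, hRpos, hR⟩ := hcomp.isBounded.exists_pos_norm_le
  have hzR : ∀ p, ‖z p‖ ≤ R := fun p => hR _ (mem_insert_of_mem _ ⟨p, rfl⟩)
  obtain ⟨C, hC0, hC⟩ := HomPoly.exists_lipschitz n E (R := R + 1) (by positivity)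
  -- The trace of the identity is arbitrarily small.
  have hsmall : ∀ η : ℝ, 0 < η → η ≤ 1 → ‖∑' i, θ i (Q i)‖ ≤ (C * ∑' p, a p / t p) * η := by
    intro η hη hη1
    obtain ⟨S, hS, hSz⟩ := hE _ hcomp η hη
    have hSz' : ∀ p, ‖S (z p) - z p‖ < η := fun p => hSz _ (mem_insert_of_mem _ ⟨p, rfl⟩)
    have hpt : ∀ p : ι × {x : E // ‖x‖ ≤ 1},
        ‖u p.1 p.2 * (Q p.1 - HomPoly.compRight n S (Q p.1)) (p.2 : E)‖ ≤
          C * η * (a p / t p) := by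
      rintro p
      rw [norm_mul, HomPoly.sub_apply, HomPoly.compRight_apply]
      by_cases hap : a p = 0
      · rw [hap, zero_div, mul_zero]
        rcases mul_eq_zero.1 hap with h0 | h0
        · rw [h0, zero_mul]
        · rw [norm_eq_zero.1 h0]; simp
      · have htp := htpos p hap
        have hsc : ∀ y : E, Q p.1 ((s p : ℂ) • y) = (t p : ℂ) * Q p.1 y := by
          intro y
          rw [HomPoly.apply_smul, ← hsn p, Complex.ofReal_pow]
        have h1 : (t p : ℂ) * (Q p.1 (p.2 : E) - Q p.1 (S p.2)) =
            Q p.1 (z p) - Q p.1 (S (z p)) := by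
          rw [mul_sub, ← hsc, ← hsc, ← map_smul]
        have h2 := hC (Q p.1) (z p) (S (z p)) (by linarith [hzR p]) (by
          have := norm_le_norm_add_norm_sub' (S (z p)) (z p)
          linarith [hzR p, hSz' p])
        rw [← h1, norm_mul, Complex.norm_real, Real.norm_of_nonneg htp.le, norm_sub_rev (z p)] at h2
        have h3 : ‖Q p.1 (p.2 : E) - Q p.1 (S p.2)‖ ≤ C * ‖Q p.1‖ * η / t p := by
          rw [le_div_iff₀ htp, mul_comm]
          exact h2.trans (by gcongr; exact (hSz' p).le)
        calc ‖u p.1 p.2‖ * ‖Q p.1 (p.2 : E) - Q p.1 (S p.2)‖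
            ≤ ‖u p.1 p.2‖ * (C * ‖Q p.1‖ * η / t p) := by gcongr
          _ = C * η * (a p / t p) := by simp only [a]; ring
    have hsm : Summable fun p => C * η * (a p / t p) := hts.mul_left _
    have hterm : ∀ i, ‖θ i (Q i) - θ i (HomPoly.compRight n S (Q i))‖ ≤
        ∑' x, C * η * (a (i, x) / t (i, x)) := by
      intro i
      rw [← map_sub]
      rw [← (HomPoly.hasSum_eval_apply (hθ i) (Q i - HomPoly.compRight n S (Q i))).tsum_eq]
      exact tsum_of_norm_bounded (hsm.prod_factor i).hasSum fun x => hpt (i, x)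
    have hsθ : ∀ R : HomPoly n E →L[ℂ] HomPoly n E, Summable fun i => θ i (R (Q i)) := by
      intro R
      refine .of_norm_bounded (hs.mul_left ‖R‖) fun i => ?_
      calc ‖θ i (R (Q i))‖ ≤ ‖θ i‖ * (‖R‖ * ‖Q i‖) :=
            (θ i).le_opNorm_of_le (R.le_opNorm _)
        _ = ‖R‖ * (‖θ i‖ * ‖Q i‖) := by ring
    have h0 := htr _ (compRight_mem hI hdual hn h hS)
    have hsid : Summable fun i => θ i (Q i) := hsθ (ContinuousLinearMap.id ℂ _)
    have hsub : ∑' i, θ i (Q i) =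
        ∑' i, (θ i (Q i) - θ i (HomPoly.compRight n S (Q i))) := by
      rw [hsid.tsum_sub (hsθ _), h0, sub_zero]
    rw [hsub]
    refine (tsum_of_norm_bounded hsm.prod.hasSum hterm).trans_eq ?_
    rw [← hsm.tsum_prod, tsum_mul_left]
    ring
  have hlim : Tendsto (fun η : ℝ => (C * ∑' p, a p / t p) * η) (𝓝[>] 0) (𝓝 0) := by
    have : Tendsto (fun η : ℝ => (C * ∑' p, a p / t p) * η) (𝓝 0)
        (𝓝 ((C * ∑' p, a p / t p) * 0)) := (continuous_const.mul continuous_id).tendsto 0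
    rw [mul_zero] at this
    exact this.mono_left nhdsWithin_le_nhds
  refine norm_le_zero_iff.1 (ge_of_tendsto hlim ?_)
  filter_upwards [Ioc_mem_nhdsGT (zero_lt_one' ℝ)] with η hη using hsmall η hη.1 hη.2

end OperatorIdeal

/-! ### The dual as a complemented subspace of the space of polynomials -/

namespace HomPoly

variable {n : ℕ} {E : Type u} [NormedAddCommGroup E] [NormedSpace ℂ E]

theorem analyticAt (P : HomPoly n E) (x : E) : AnalyticAt ℂ (fun y => P y) x := by
  obtain ⟨A, rfl⟩ := exists_diag_eq P
  exact A.analyticAt.comp_of_eq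
    ((ContinuousLinearMap.pi fun _ : Fin n => ContinuousLinearMap.id ℂ E).analyticAt x) rfl

/-- The derivative at `a`, as a continuous linear function of the polynomial. -/
noncomputable def fderivAt (n : ℕ) (a : E) : HomPoly n E →L[ℂ] StrongDual ℂ E :=
  LinearMap.mkContinuous
    { toFun := fun P => fderiv ℂ (fun x => P x) a
      map_add' := fun P Q =>
        fderiv_fun_add (P.analyticAt a).differentiableAt (Q.analyticAt a).differentiableAt
      map_smul' := fun c P => fderiv_fun_const_smul (P.analyticAt a).differentiableAt c }
    (exists_lipschitz n E (R := ‖a‖ + 1) (by positivity)).choose fun P => by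
      obtain ⟨hC, h⟩ := (exists_lipschitz n E (R := ‖a‖ + 1) (by positivity)).choose_spec
      refine norm_fderiv_le_of_lip' ℂ (by positivity) ?_
      filter_upwards [Metric.ball_mem_nhds a one_pos] with x hx
      refine h P x a ?_ (by linarith)
      have h1 := norm_le_norm_add_norm_sub' x a
      have h2 : ‖x - a‖ < 1 := by simpa [dist_eq_norm] using hx
      linarith

theorem fderivAt_apply (a : E) (P : HomPoly n E) :
    fderivAt n a P = fderiv ℂ (fun x => P x) a := rfl

/-- The map `φ ↦ φ ψᵐ` from the dual of `E` to the `(m + 1)`-homogeneous polynomials. -/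
noncomputable def dualMulPow (ψ : StrongDual ℂ E) (m : ℕ) :
    StrongDual ℂ E →L[ℂ] HomPoly (m + 1) E :=
  LinearMap.mkContinuous
    { toFun := fun φ => ⟨fun x => φ x * ψ x ^ m,
        (ContinuousMultilinearMap.mkPiAlgebra ℂ (Fin (m + 1)) ℂ).compContinuousLinearMap
          (Fin.cons φ fun _ => ψ : Fin (m + 1) → StrongDual ℂ E),
        fun x => by simp [Fin.prod_univ_succ]⟩
      map_add' := fun φ χ => ext fun x => add_mul _ _ _
      map_smul' := fun c φ => ext fun x => mul_assoc _ _ _ } (‖ψ‖ ^ m) fun φ => by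
    refine norm_le _ fun x hx => ?_
    change ‖φ x * ψ x ^ m‖ ≤ _
    rw [norm_mul, norm_pow, mul_comm]
    gcongr
    · exact ψ.unit_le_opNorm x hx
    · exact φ.unit_le_opNorm x hx

@[simp] theorem dualMulPow_apply (ψ : StrongDual ℂ E) (m : ℕ) (φ : StrongDual ℂ E) (x : E) :
    dualMulPow ψ m φ x = φ x * ψ x ^ m := rfl

theorem fderivAt_dualMulPow (ψ : StrongDual ℂ E) (m : ℕ) (φ : StrongDual ℂ E) (a : E) :
    fderivAt (m + 1) a (dualMulPow ψ m φ) =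
      φ a • (m * ψ a ^ (m - 1)) • ψ + ψ a ^ m • φ := by
  have h := φ.hasFDerivAt.mul (ψ.hasFDerivAt (x := a) |>.pow m)
  rw [fderivAt_apply]
  refine (h.congr_fderiv ?_).fderiv
  simp

/-- A projection of the `(m + 1)`-homogeneous polynomials onto the copy `{φ ψᵐ}` of the dual: if
`ψ a = 1`, then `φ` is recovered from `P = φ ψᵐ` as `P'(a) - m P(a) ψ`. -/
theorem exists_retraction_dualMulPow (ψ : StrongDual ℂ E) (m : ℕ) {a : E} (ha : ψ a = 1) :
    ∃ p : HomPoly (m + 1) E →L[ℂ] StrongDual ℂ E, ∀ φ, p (dualMulPow ψ m φ) = φ := by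
  refine ⟨fderivAt (m + 1) a - (m : ℂ) • (eval (m + 1) a).smulRight ψ, fun φ => ?_⟩
  rw [_root_.sub_apply, fderivAt_dualMulPow]
  ext x
  simp [ha]
  ring

/-- The `1`-homogeneous polynomials are the continuous linear functionals. The two maps are
`φ ↦ φ · 0⁰` and the derivative at `0`. -/
noncomputable def dualEquiv (E : Type u) [NormedAddCommGroup E] [NormedSpace ℂ E] :
    StrongDual ℂ E ≃L[ℂ] HomPoly 1 E :=
  have hl : ∀ φ, fderivAt 1 0 (dualMulPow (0 : StrongDual ℂ E) 0 φ) = φ := fun φ => by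
    rw [fderivAt_dualMulPow]; ext x; simp
  ContinuousLinearEquiv.equivOfInverse (dualMulPow 0 0) (fderivAt 1 0) hl fun P => by
    obtain ⟨A, rfl⟩ := exists_diag_eq P
    have h : dualMulPow 0 0 (A.toContinuousLinearMap (fun _ => 0) 0) = diag 1 E A := by
      refine ext fun x => ?_
      rw [dualMulPow_apply, pow_zero, mul_one, diag_apply]
      change A (Function.update _ 0 x) = _
      congr 1
      ext i
      rw [Subsingleton.elim i 0, Function.update_self]
    rw [← h, hl]

end HomPoly

theorem PolynomiallyReflexive.isReflexiveSpace {E : Type u} [NormedAddCommGroup E]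
    [NormedSpace ℂ E] [CompleteSpace E] (h : PolynomiallyReflexive E) : IsReflexiveSpace E :=
  .of_strongDual ((h 1 le_rfl).of_equiv (HomPoly.dualEquiv E).symm)

theorem HomPoly.fderivAt_one {E : Type u} [NormedAddCommGroup E] [NormedSpace ℂ E]
    (P : HomPoly 1 E) (x : E) : fderivAt 1 0 P x = P x := by
  conv_rhs => rw [← (dualEquiv E).apply_symm_apply P]
  change _ = (dualEquiv E).symm P x * 0 ^ 0
  rw [pow_zero, mul_one]
  rfl

namespace OperatorIdeal

variable {I : OperatorIdeal.{u}} {n : ℕ} {E : Type u} [NormedAddCommGroup E] [NormedSpace ℂ E]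

theorem HasAP.strongDual_of_homPoly (hn : 1 ≤ n) (hE : I.HasAP (HomPoly n E)) :
    I.HasAP (StrongDual ℂ E) := by
  obtain ⟨m, rfl⟩ := Nat.exists_eq_add_of_le' hn
  rcases subsingleton_or_nontrivial E with hsub | hnon
  · rw [hasAP_iff]
    intro K _ ε hε
    refine ⟨0, Submodule.zero_mem _, fun φ _ => ?_⟩
    have : φ = 0 := by ext x; rw [Subsingleton.elim x 0]; simp
    simpa [this] using hε
  · obtain ⟨x, hx⟩ := exists_ne (0 : E)
    obtain ⟨ψ, hψ⟩ := SeparatingDual.exists_eq_one (R := ℂ) hx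
    obtain ⟨p, hp⟩ := HomPoly.exists_retraction_dualMulPow ψ m hψ
    exact hE.of_retract _ p hp

/-- On reflexive spaces the `I`-approximation property passes from the dual to the space, which
is the space of `1`-homogeneous polynomials on its dual. -/
theorem HasAP.of_strongDual [CompleteSpace E] (hI : I.FactorizationLeComposition)
    (hdual : I.LeDual ∨ I.DualLe) (h : IsReflexiveSpace E) (hE : I.HasAP (StrongDual ℂ E)) : I.HasAP E := by
  have h1 := hE.homPoly hI hdual le_rfl
    (h.strongDual.strongDual.of_equiv (HomPoly.dualEquiv (StrongDual ℂ E)))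
  let e := h.equivBidual.toContinuousLinearEquiv.trans (HomPoly.dualEquiv (StrongDual ℂ E))
  exact h1.of_retract (e : E →L[ℂ] _) (e.symm : _ →L[ℂ] E) fun x => e.symm_apply_apply x

end OperatorIdeal

/-! ### `U`-bounded sets -/

section UBounded

variable {E : Type u} [NormedAddCommGroup E] {U : Set E}

theorem mem_uBounded_iff {A : Set U} : A ∈ uBounded U ↔
    ∃ R > 0, ∃ r > 0, ∀ x ∈ A, ‖(x : E)‖ ≤ R ∧ ∀ w : E, ‖w‖ < r → (x : E) + w ∈ U := by
  constructor
  · rintro ⟨hb, V, hV, hVU⟩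
    obtain ⟨R, hR, hRA⟩ := hb.exists_pos_norm_le
    obtain ⟨r, hr, hrV⟩ := Metric.mem_nhds_iff.1 hV
    exact ⟨R, hR, r, hr, fun x hx => ⟨hRA _ ⟨x, hx, rfl⟩, fun w hw =>
      hVU (add_mem_add ⟨x, hx, rfl⟩ (hrV (by simpa using hw)))⟩⟩
  · rintro ⟨R, -, r, hr, h⟩
    refine ⟨isBounded_iff_forall_norm_le.2 ⟨R, ?_⟩, Metric.ball 0 r, Metric.ball_mem_nhds 0 hr, ?_⟩
    · rintro _ ⟨x, hx, rfl⟩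
      exact (h x hx).1
    · rintro _ ⟨_, ⟨x, hx, rfl⟩, w, hw, rfl⟩
      exact (h x hx).2 w (by simpa using hw)

theorem empty_mem_uBounded : (∅ : Set U) ∈ uBounded U :=
  mem_uBounded_iff.2 ⟨1, one_pos, 1, one_pos, by simp⟩

theorem union_mem_uBounded {A B : Set U} (hA : A ∈ uBounded U) (hB : B ∈ uBounded U) :
    A ∪ B ∈ uBounded U := by
  obtain ⟨R, hR, r, hr, h⟩ := mem_uBounded_iff.1 hA
  obtain ⟨R', hR', r', hr', h'⟩ := mem_uBounded_iff.1 hB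
  refine mem_uBounded_iff.2 ⟨max R R', lt_max_of_lt_left hR, min r r', lt_min hr hr', ?_⟩
  rintro x (hx | hx)
  · exact ⟨(h x hx).1.trans (le_max_left _ _),
      fun w hw => (h x hx).2 w (hw.trans_le (min_le_left _ _))⟩
  · exact ⟨(h' x hx).1.trans (le_max_right _ _),
      fun w hw => (h' x hx).2 w (hw.trans_le (min_le_right _ _))⟩

theorem exists_closedBall_mem_uBounded (hUo : IsOpen U) (h0 : (0 : E) ∈ U) :
    ∃ ρ > 0, (∀ x : E, ‖x‖ ≤ ρ → x ∈ U) ∧ {x : U | ‖(x : E)‖ ≤ ρ} ∈ uBounded U := by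
  obtain ⟨r, hr, hrU⟩ := Metric.isOpen_iff.1 hUo 0 h0
  have hr' : ∀ x : E, ‖x‖ < r → x ∈ U := fun x hx => hrU (by simpa using hx)
  refine ⟨r / 2, by positivity, fun x hx => hr' x (by linarith),
    mem_uBounded_iff.2 ⟨r / 2, by positivity, r / 2, by positivity, fun x hx => ⟨hx, fun w hw =>
      hr' _ ((norm_add_le _ _).trans_lt ?_)⟩⟩⟩
  have : ‖(x : E)‖ ≤ r / 2 := hx
  linarith

variable [NormedSpace ℂ E]

/-- In a balanced open set, the multiples `c • x` of the points `x` of a `U`-bounded set with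
`‖c‖ ≤ s` still form a `U`-bounded set, for some `s > 1`. -/
theorem exists_smul_mem_uBounded (hUo : IsOpen U) (hUb : Balanced ℂ U) (h0 : (0 : E) ∈ U)
    {A : Set U} (hA : A ∈ uBounded U) :
    ∃ s > (1 : ℝ), ∃ D ∈ uBounded U, ∀ x ∈ A, ∀ c : ℂ, ‖c‖ ≤ s →
      ∃ h : c • (x : E) ∈ U, (⟨c • (x : E), h⟩ : U) ∈ D := by
  obtain ⟨R, hR, r₁, hr₁, hAr⟩ := mem_uBounded_iff.1 hA
  obtain ⟨r₂, hr₂, hr₂U⟩ := Metric.isOpen_iff.1 hUo 0 h0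
  set r := min r₁ r₂ with hrdef
  have hr : 0 < r := lt_min hr₁ hr₂
  have hball : ∀ x : E, ‖x‖ < r → x ∈ U := fun x hx =>
    hr₂U (by simpa using hx.trans_le (min_le_right _ _))
  have hadd : ∀ x ∈ A, ∀ w : E, ‖w‖ < r → (x : E) + w ∈ U := fun x hx w hw =>
    (hAr x hx).2 w (hw.trans_le (min_le_left _ _))
  set s : ℝ := 1 + r / (2 * R) with hs
  have hs1 : 1 < s := by rw [hs]; linarith [show 0 < r / (2 * R) by positivity]
  have hs0 : 0 < s := by linarith
  have hsR : (s - 1) * R = r / 2 := by rw [hs]; field_simp; ring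
  -- Multipliers below `m` lead into a ball around `0`, the others are handled by balancedness.
  set m : ℝ := r / (2 * s * R) with hm
  have hm0 : 0 < m := by positivity
  have hmR : m * s * R = r / 2 := by rw [hm]; field_simp
  set δ : ℝ := min (r / 2) (m * (r / 2)) with hδ
  have hδ0 : 0 < δ := by positivity
  have key : ∀ x ∈ A, ∀ c : ℂ, ‖c‖ ≤ s → ∀ w : E, ‖w‖ < δ → c • (x : E) + w ∈ U := by
    intro x hx c hc w hw
    have hxR := (hAr x hx).1
    have hsc : (s : ℂ) ≠ 0 := by exact_mod_cast hs0.ne'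
    rcases lt_or_ge ‖c‖ (m * s) with hlt | hge
    · refine hball _ ((norm_add_le _ _).trans_lt ?_)
      rw [norm_smul]
      have h1 : ‖c‖ * ‖(x : E)‖ ≤ m * s * R := by gcongr
      have h2 : ‖w‖ < r / 2 := hw.trans_le (min_le_left _ _)
      linarith
    · have hc0 : c ≠ 0 := norm_pos_iff.1 (lt_of_lt_of_le (by positivity) hge)
      have hμ : ‖c / s‖ ≤ 1 := by
        rw [norm_div, Complex.norm_real, Real.norm_of_nonneg hs0.le, div_le_one hs0]
        exact hc
      have hw' : ‖((s : ℂ) / c) • w‖ < r / 2 := by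
        rw [norm_smul, norm_div, Complex.norm_real, Real.norm_of_nonneg hs0.le]
        have h2 : ‖w‖ < m * (r / 2) := hw.trans_le (min_le_right _ _)
        have hcpos : 0 < ‖c‖ := norm_pos_iff.2 hc0
        rw [div_mul_eq_mul_div, div_lt_iff₀ hcpos]
        nlinarith
      have hmem : (x : E) + (((s : ℂ) - 1) • (x : E) + ((s : ℂ) / c) • w) ∈ U := by
        refine hadd x hx _ ((norm_add_le _ _).trans_lt ?_)
        have h3 : ‖((s : ℂ) - 1) • (x : E)‖ ≤ r / 2 := by
          rw [norm_smul, ← hsR]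
          have : ‖(s : ℂ) - 1‖ = s - 1 := by
            rw [← Complex.ofReal_one, ← Complex.ofReal_sub, Complex.norm_real,
              Real.norm_of_nonneg (by linarith)]
          rw [this]
          gcongr
        linarith
      have := hUb.smul_mem hμ hmem
      convert this using 1
      rw [← add_assoc, smul_add, smul_smul, sub_smul, one_smul, add_sub_cancel, smul_smul,
        div_mul_cancel₀ _ hsc, div_mul_div_cancel₀ hsc, div_self hc0, one_smul]
  refine ⟨s, hs1, {z | ∃ x ∈ A, ∃ c : ℂ, ‖c‖ ≤ s ∧ (z : E) = c • (x : E)},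
    mem_uBounded_iff.2 ⟨s * R, by positivity, δ, hδ0, ?_⟩, fun x hx c hc => ?_⟩
  · rintro z ⟨x, hx, c, hc, hz⟩
    rw [hz]
    refine ⟨?_, key x hx c hc⟩
    rw [norm_smul]
    gcongr
    exact (hAr x hx).1
  · have := key x hx c hc 0 (by simpa using hδ0)
    rw [add_zero] at this
    exact ⟨this, x, hx, c, hc, rfl⟩

end UBounded

/-! ### Cauchy estimates -/

section Cauchy

variable {E : Type u} [NormedAddCommGroup E] [NormedSpace ℂ E]

/-- Cauchy estimate for the homogeneous parts of a power series along a complex line, together with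
the convergence of the series. -/
theorem HasFPowerSeriesAt.norm_apply_diag_le_and_hasSum {g : E → ℂ}
    {p : FormalMultilinearSeries ℂ E ℂ} (hp : HasFPowerSeriesAt g p 0) {x : E} {s M : ℝ}
    (hs : 0 < s) (hg : ∀ c : ℂ, ‖c‖ ≤ s → AnalyticAt ℂ g (c • x))
    (hM : ∀ c : ℂ, ‖c‖ ≤ s → ‖g (c • x)‖ ≤ M) :
    (∀ n, ‖p n fun _ => x‖ ≤ M * s⁻¹ ^ n) ∧ (1 < s → HasSum (fun n => p n fun _ => x) (g x)) := by
  set L : ℂ →L[ℂ] E := ContinuousLinearMap.toSpanSingleton ℂ x with hL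
  lift s to NNReal using hs.le
  have hM0 : 0 ≤ M := (norm_nonneg _).trans (hM 0 (by simp))
  have h1 : HasFPowerSeriesAt (g ∘ L) (p.compContinuousLinearMap L) 0 :=
    HasFPowerSeriesAt.compContinuousLinearMap (by simpa using hp)
  have hd : DifferentiableOn ℂ (g ∘ L) (Metric.closedBall 0 s) := by
    intro c hc
    have hc' : ‖c‖ ≤ s := by simpa using hc
    have h3 : AnalyticAt ℂ g (L c) := hg c hc'
    exact ((h3.comp (L.analyticAt c)).differentiableAt).differentiableWithinAt
  have h2 : HasFPowerSeriesOnBall (g ∘ L) (cauchyPowerSeries (g ∘ L) 0 s) 0 s :=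
    hd.hasFPowerSeriesOnBall (by exact_mod_cast hs)
  have heq := h1.eq_formalMultilinearSeries h2.hasFPowerSeriesAt
  have hcoef : ∀ n, p n (fun _ => x) = cauchyPowerSeries (g ∘ L) 0 s n fun _ => 1 := by
    intro n
    rw [← heq, FormalMultilinearSeries.compContinuousLinearMap_apply]
    congr 1
    ext i
    simp [hL]
  refine ⟨fun n => ?_, fun hs1 => ?_⟩
  · rw [hcoef]
    refine (ContinuousMultilinearMap.le_opNorm _ _).trans ?_
    simp only [norm_one, Finset.prod_const_one, mul_one]
    refine (norm_cauchyPowerSeries_le _ _ _ _).trans ?_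
    rw [NNReal.abs_eq]
    gcongr
    have h4 : ‖∫ θ in (0 : ℝ)..2 * Real.pi, ‖(g ∘ L) (circleMap 0 s θ)‖‖ ≤
        M * |2 * Real.pi - 0| := by
      refine intervalIntegral.norm_integral_le_of_norm_le_const fun θ _ => ?_
      rw [norm_norm]
      exact hM _ (by simp)
    rw [sub_zero, abs_of_pos Real.two_pi_pos] at h4
    rw [inv_mul_le_iff₀ Real.two_pi_pos]
    linarith [(Real.le_norm_self _).trans h4]
  · simp only [hcoef]
    have h5 := h2.hasSum (y := 1) (by
      rw [mem_eball_zero_iff, enorm_one]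
      exact_mod_cast hs1)
    simpa [hL] using h5

end Cauchy

/-! ### Taylor polynomials of holomorphic functions of bounded type -/

namespace Hb

variable {E : Type u} [NormedAddCommGroup E] [NormedSpace ℂ E] {U : Set E}

/-- The value of a function of `H_b(U)` at a point of `U`. -/
def val (f : Hb U) (x : U) : ℂ := UniformOnFun.toFun (uBounded U) f.1 x

@[simp] theorem val_add (f g : Hb U) (x : U) : (f + g).val x = f.val x + g.val x := rfl

@[simp] theorem val_sub (f g : Hb U) (x : U) : (f - g).val x = f.val x - g.val x := rfl

@[simp] theorem val_smul (c : ℂ) (f : Hb U) (x : U) : (c • f).val x = c * f.val x := rfl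

theorem val_sum {ι : Type*} (s : Finset ι) (f : ι → Hb U) (x : U) :
    (∑ i ∈ s, f i).val x = ∑ i ∈ s, (f i).val x :=
  map_sum (⟨⟨fun f : Hb U => f.val x, rfl⟩, fun _ _ => rfl⟩ : Hb U →+ ℂ) f s

theorem mem_nhds_zero_iff {W : Set (Hb U)} : W ∈ 𝓝 (0 : Hb U) ↔
    ∃ A ∈ uBounded U, ∃ δ > 0, ∀ f : Hb U, (∀ x ∈ A, ‖f.val x‖ < δ) → f ∈ W := by
  have hb := UniformOnFun.hasBasis_nhds_zero_of_basis (uBounded U) ⟨∅, empty_mem_uBounded⟩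
    (directedOn_of_sup_mem fun _ _ => union_mem_uBounded)
    (Metric.nhds_basis_ball (x := (0 : ℂ)))
  have hb' := (hb.comap (Subtype.val : Hb U → _)).mem_iff (t := W)
  rw [nhds_subtype]
  refine hb'.trans ⟨?_, ?_⟩
  · rintro ⟨⟨A, δ⟩, ⟨hA, hδ⟩, h⟩
    exact ⟨A, hA, δ, hδ, fun f hf => h fun x hx => by
      simpa using! hf x hx⟩
  · rintro ⟨A, hA, δ, hδ, h⟩
    exact ⟨⟨A, δ⟩, ⟨hA, hδ⟩, fun f hf => h f fun x hx => by simpa using! hf x hx⟩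

theorem exists_val_le (f : Hb U) {A : Set U} (hA : A ∈ uBounded U) :
    ∃ M, ∀ x ∈ A, ‖f.val x‖ ≤ M := by
  obtain ⟨M, hM⟩ := (f.2.2 A hA).exists_norm_le
  exact ⟨M, fun x hx => hM _ ⟨x, hx, rfl⟩⟩

theorem exists_val_le_of_isCompact {K : Set (Hb U)} (hK : IsCompact K) {A : Set U}
    (hA : A ∈ uBounded U) : ∃ M, ∀ f ∈ K, ∀ x ∈ A, ‖f.val x‖ ≤ M := by
  refine hK.induction_on (p := fun S => ∃ M, ∀ f ∈ S, ∀ x ∈ A, ‖f.val x‖ ≤ M) ⟨0, by simp⟩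
    (fun S T hST ⟨M, hM⟩ => ⟨M, fun f hf => hM f (hST hf)⟩) ?_ fun f _ => ?_
  · rintro S T ⟨M, hM⟩ ⟨N, hN⟩
    refine ⟨max M N, ?_⟩
    rintro f (hf | hf) x hx
    · exact (hM f hf x hx).trans (le_max_left _ _)
    · exact (hN f hf x hx).trans (le_max_right _ _)
  · obtain ⟨M, hM⟩ := f.exists_val_le hA
    have h1 : {g : Hb U | ∀ x ∈ A, ‖g.val x‖ < 1} ∈ 𝓝 (0 : Hb U) :=
      mem_nhds_zero_iff.2 ⟨A, hA, 1, one_pos, fun _ h => h⟩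
    have h2 : (fun g => g - f) ⁻¹' {g : Hb U | ∀ x ∈ A, ‖g.val x‖ < 1} ∈ 𝓝 f :=
      (continuous_id.sub continuous_const).continuousAt.preimage_mem_nhds (by simpa using h1)
    refine ⟨_, mem_nhdsWithin_of_mem_nhds h2, M + 1, fun g hg x hx => ?_⟩
    have h3 : ‖g.val x - f.val x‖ < 1 := hg x hx
    have h4 := norm_le_norm_add_norm_sub' (g.val x) (f.val x)
    linarith [hM x hx]

open scoped Classical in
/-- The extension by zero of a function of `H_b(U)` to the whole space. -/
noncomputable def extend (f : Hb U) (x : E) : ℂ := if h : x ∈ U then f.val ⟨x, h⟩ else 0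

theorem extend_of_mem (f : Hb U) {x : E} (h : x ∈ U) : f.extend x = f.val ⟨x, h⟩ := dif_pos h

theorem extend_add (f g : Hb U) : (f + g).extend = f.extend + g.extend := by
  ext x
  by_cases h : x ∈ U <;> simp [extend, h]

theorem extend_smul (c : ℂ) (f : Hb U) : (c • f).extend = c • f.extend := by
  ext x
  by_cases h : x ∈ U <;> simp [extend, h]

theorem analyticAt_extend (hUo : IsOpen U) (f : Hb U) {x : E} (hx : x ∈ U) :
    AnalyticAt ℂ f.extend x := by
  obtain ⟨g, hg, hfg⟩ := f.2.1
  refine (hg x hx).congr ?_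
  filter_upwards [hUo.mem_nhds hx] with y hy
  rw [f.extend_of_mem hy]
  exact (hfg ⟨y, hy⟩).symm

/-- The `n`-th homogeneous Taylor polynomial at `0`, as a linear map. -/
noncomputable def taylorₗ (hUo : IsOpen U) (h0 : (0 : E) ∈ U) (n : ℕ) :
    Hb U →ₗ[ℂ] HomPoly n E where
  toFun f := HomPoly.diag n E ((n.factorial : ℂ)⁻¹ • iteratedFDeriv ℂ n f.extend 0)
  map_add' f g := by
    rw [extend_add, iteratedFDeriv_add_apply (analyticAt_extend hUo f h0).contDiffAt
      (analyticAt_extend hUo g h0).contDiffAt, smul_add, map_add]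
  map_smul' c f := by
    rw [extend_smul, iteratedFDeriv_const_smul_apply (analyticAt_extend hUo f h0).contDiffAt,
      smul_comm, map_smul, RingHom.id_apply]

theorem taylorₗ_apply (hUo : IsOpen U) (h0 : (0 : E) ∈ U) (n : ℕ) (f : Hb U) (x : E) :
    taylorₗ hUo h0 n f x = (n.factorial : ℂ)⁻¹ * iteratedFDeriv ℂ n f.extend 0 fun _ => x := rfl

/-- Cauchy estimates for the Taylor polynomials, and convergence of the Taylor series on sets which
stay in `U` under multiplication by a factor greater than `1`. -/
theorem norm_taylorₗ_le_and_hasSum (hUo : IsOpen U) (h0 : (0 : E) ∈ U) (f : Hb U) {x : E}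
    {s M : ℝ} (hs : 0 < s)
    (hx : ∀ c : ℂ, ‖c‖ ≤ s → ∃ h : c • x ∈ U, ‖f.val ⟨c • x, h⟩‖ ≤ M) :
    (∀ n, ‖taylorₗ hUo h0 n f x‖ ≤ M * s⁻¹ ^ n) ∧
      (1 < s → HasSum (fun n => taylorₗ hUo h0 n f x) (f.extend x)) := by
  obtain ⟨p, hp⟩ := analyticAt_extend hUo f h0
  have hcoef : ∀ n, taylorₗ hUo h0 n f x = p n fun _ => x := by
    intro n
    obtain ⟨r, hr⟩ := hp
    have hfac : (n.factorial : ℂ) ≠ 0 := by exact_mod_cast n.factorial_ne_zero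
    rw [taylorₗ_apply, ← hr.factorial_smul x n, nsmul_eq_mul, inv_mul_cancel_left₀ hfac]
  simp only [hcoef]
  refine hp.norm_apply_diag_le_and_hasSum hs (fun c hc => ?_) fun c hc => ?_
  · exact analyticAt_extend hUo f (hx c hc).1
  · obtain ⟨h, hM⟩ := hx c hc
    rwa [f.extend_of_mem h]

/-- The `n`-th homogeneous Taylor polynomial at `0`, as a continuous linear map. -/
noncomputable def taylor (hUo : IsOpen U) (h0 : (0 : E) ∈ U) (n : ℕ) :
    Hb U →L[ℂ] HomPoly n E where
  toLinearMap := taylorₗ hUo h0 n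
  cont := by
    refine continuous_of_continuousAt_zero (taylorₗ hUo h0 n) ?_
    rw [ContinuousAt, map_zero, Metric.tendsto_nhds]
    intro ε hε
    obtain ⟨ρ, hρ, hρU, hρb⟩ := exists_closedBall_mem_uBounded hUo h0
    refine mem_nhds_zero_iff.2 ⟨_, hρb, ε / 2 * ρ ^ n, by positivity, fun f hf => ?_⟩
    change dist (taylorₗ hUo h0 n f) 0 < ε
    rw [dist_zero_right]
    refine (HomPoly.norm_le _ (C := ε / 2) fun x hx => ?_).trans_lt (by linarith)
    have h1 := (norm_taylorₗ_le_and_hasSum hUo h0 f (x := x) (M := ε / 2 * ρ ^ n) hρ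
      fun c hc => ?_).1 n
    · refine h1.trans_eq ?_
      rw [mul_assoc, ← mul_pow, mul_inv_cancel₀ hρ.ne', one_pow, mul_one]
    · have h2 : ‖c • x‖ ≤ ρ := by
        rw [norm_smul]
        exact (mul_le_of_le_one_right (norm_nonneg _) hx).trans hc
      exact ⟨hρU _ h2, (hf ⟨c • x, hρU _ h2⟩ h2).le⟩

@[simp] theorem taylor_apply (hUo : IsOpen U) (h0 : (0 : E) ∈ U) (n : ℕ) (f : Hb U) :
    taylor hUo h0 n f = taylorₗ hUo h0 n f := rfl

/-- The restriction of homogeneous polynomials to `U`, as a linear map. -/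
def ofHomPolyₗ (U : Set E) (n : ℕ) : HomPoly n E →ₗ[ℂ] Hb U where
  toFun P := ⟨UniformOnFun.ofFun (uBounded U) fun x => P x,
    ⟨fun x => P x, fun x _ => P.analyticAt x, fun _ => rfl⟩, fun A hA => by
      obtain ⟨R, hR, r, -, h⟩ := mem_uBounded_iff.1 hA
      refine isBounded_iff_forall_norm_le.2 ⟨‖P‖ * R ^ n, ?_⟩
      rintro _ ⟨x, hx, rfl⟩
      exact (P.apply_le x).trans (by gcongr; exact (h x hx).1)⟩
  map_add' _ _ := rfl
  map_smul' _ _ := rfl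

@[simp] theorem val_ofHomPolyₗ (n : ℕ) (P : HomPoly n E) (x : U) :
    (ofHomPolyₗ U n P).val x = P x := rfl

/-- The restriction of homogeneous polynomials to `U`, as a continuous linear map. -/
def ofHomPoly (U : Set E) (n : ℕ) : HomPoly n E →L[ℂ] Hb U where
  toLinearMap := ofHomPolyₗ U n
  cont := by
    refine continuous_of_continuousAt_zero (ofHomPolyₗ U n) ?_
    rw [ContinuousAt, map_zero]
    intro W hW
    obtain ⟨A, hA, δ, hδ, hAW⟩ := mem_nhds_zero_iff.1 hW
    obtain ⟨R, hR, r, -, h⟩ := mem_uBounded_iff.1 hA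
    refine mem_map.2 (mem_of_superset (Metric.ball_mem_nhds 0
      (show 0 < δ / R ^ n by positivity)) fun P hP => hAW _ fun x hx => ?_)
    rw [val_ofHomPolyₗ]
    rw [mem_ball_zero_iff, lt_div_iff₀ (by positivity)] at hP
    exact ((P.apply_le x).trans (by gcongr; exact (h x hx).1)).trans_lt hP

@[simp] theorem val_ofHomPoly (n : ℕ) (P : HomPoly n E) (x : U) : (ofHomPoly U n P).val x = P x :=
  rfl

theorem taylor_one_ofHomPoly (hUo : IsOpen U) (h0 : (0 : E) ∈ U) (P : HomPoly 1 E) :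
    taylor hUo h0 1 (ofHomPoly U 1 P) = P := by
  refine HomPoly.ext fun x => ?_
  rw [taylor_apply, taylorₗ_apply, iteratedFDeriv_one_apply, ← HomPoly.fderivAt_one P x,
    HomPoly.fderivAt_apply]
  have h1 : (ofHomPoly U 1 P).extend =ᶠ[𝓝 0] fun x => P x := by
    filter_upwards [hUo.mem_nhds h0] with y hy
    rw [extend_of_mem _ hy, val_ofHomPoly]
  rw [h1.fderiv_eq]
  simp

end Hb

/-! ### The approximation property of spaces of holomorphic functions -/

namespace Hb

variable {E : Type u} [NormedAddCommGroup E] [NormedSpace ℂ E] {U : Set E}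

/-- On a balanced open set, Taylor series converge uniformly on compact sets of functions. -/
theorem exists_taylor_approx (hUo : IsOpen U) (hUb : Balanced ℂ U) (h0 : (0 : E) ∈ U)
    {K : Set (Hb U)} (hK : IsCompact K) {A : Set U} (hA : A ∈ uBounded U) {ε : ℝ} (hε : 0 < ε) :
    ∃ N, ∀ f ∈ K, ∀ x ∈ A, ‖∑ n ∈ Finset.range N, taylor hUo h0 n f x - f.val x‖ < ε := by
  obtain ⟨s, hs, D, hD, hDA⟩ := exists_smul_mem_uBounded hUo hUb h0 hA
  obtain ⟨M, hM⟩ := exists_val_le_of_isCompact hK hD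
  have hs0 : 0 < s := by linarith
  have hs1 : s⁻¹ < 1 := inv_lt_one_of_one_lt₀ hs
  have hlim : Tendsto (fun N : ℕ => M * s⁻¹ ^ N / (1 - s⁻¹)) atTop (𝓝 0) := by
    have := ((tendsto_pow_atTop_nhds_zero_of_lt_one (by positivity) hs1).const_mul M).div_const
      (1 - s⁻¹)
    simpa using this
  obtain ⟨N, hN⟩ := (hlim.eventually (gt_mem_nhds hε)).exists
  refine ⟨N, fun f hf x hx => ?_⟩
  obtain ⟨h1, h2⟩ := norm_taylorₗ_le_and_hasSum hUo h0 f (x := (x : E)) (M := M) hs0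
    fun c hc => by
      obtain ⟨h, hcD⟩ := hDA x hx c hc
      exact ⟨h, hM f hf _ hcD⟩
  have h3 := norm_sub_le_of_geometric_bound_of_hasSum hs1 h1 (h2 hs) N
  rw [f.extend_of_mem x.2] at h3
  exact h3.trans_lt hN

end Hb

namespace OperatorIdeal

variable {I : OperatorIdeal.{u}} {E : Type u} [NormedAddCommGroup E] [NormedSpace ℂ E]

theorem hasAP_homPoly_zero : I.HasAP (HomPoly 0 E) := by
  have hinj : Function.Injective (HomPoly.eval 0 (0 : E)).toLinearMap := by
    intro P Q h
    refine HomPoly.ext fun x => ?_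
    obtain ⟨A, rfl⟩ := HomPoly.exists_diag_eq P
    obtain ⟨B, rfl⟩ := HomPoly.exists_diag_eq Q
    have h1 : A (fun _ => 0) = B fun _ => 0 := h
    rw [HomPoly.diag_apply, HomPoly.diag_apply, Subsingleton.elim (fun _ : Fin 0 => x) fun _ => 0,
      h1]
  have : FiniteDimensional ℂ (HomPoly 0 E) := FiniteDimensional.of_injective _ hinj
  rw [hasAP_iff]
  exact fun K _ ε hε => ⟨ContinuousLinearMap.id ℂ _, I.finiteRank_mem _ inferInstance,
    fun P _ => by simpa using hε⟩

/-- If all the spaces of homogeneous polynomials have the `I`-approximation property, so does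
`H_b(U)`: the identity is approximated by Taylor expansion, and each homogeneous part factors
through the corresponding space of polynomials. -/
theorem hasAPLC_hb {U : Set E} (hUo : IsOpen U) (hUb : Balanced ℂ U) (h0 : (0 : E) ∈ U)
    (h : ∀ n, I.HasAP (HomPoly n E)) : I.HasAPLC (Hb U) := by
  rw [hasAPLC_iff]
  intro K hK W hW
  obtain ⟨A, hA, δ, hδ, hAW⟩ := Hb.mem_nhds_zero_iff.1 hW
  obtain ⟨R, hR, r, -, hAR⟩ := mem_uBounded_iff.1 hA
  obtain ⟨N, hN⟩ := Hb.exists_taylor_approx hUo hUb h0 hK hA (half_pos hδ)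
  have hS : ∀ n, ∃ S ∈ I.comp (HomPoly n E) (HomPoly n E), ∀ f ∈ K,
      ‖S (Hb.taylor hUo h0 n f) - Hb.taylor hUo h0 n f‖ < δ / (2 * (N + 1)) / R ^ n := by
    intro n
    obtain ⟨S, hS, hSK⟩ := hasAP_iff.1 (h n) _ (hK.image (Hb.taylor hUo h0 n).continuous)
      (δ / (2 * (N + 1)) / R ^ n) (by positivity)
    exact ⟨S, hS, fun f hf => hSK _ ⟨f, hf, rfl⟩⟩
  choose S hSI hSK using hS
  refine ⟨∑ n ∈ Finset.range N, ((Hb.ofHomPoly U n).comp (S n)).comp (Hb.taylor hUo h0 n),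
    sum_mem_infExt _ fun n _ => ⟨_, _, _, _, _, _, _, _, _, _, _, hSI n, rfl⟩,
    fun f hf => hAW _ fun x hx => ?_⟩
  have hterm : ∀ n, ‖(S n (Hb.taylor hUo h0 n f) - Hb.taylor hUo h0 n f) (x : E)‖ ≤
      δ / (2 * (N + 1)) := by
    intro n
    refine (HomPoly.apply_le _ _).trans ?_
    have h1 := (hSK n f hf).le
    rw [le_div_iff₀ (by positivity)] at h1
    refine le_trans ?_ h1
    gcongr
    exact (hAR x hx).1
  have hsum : ‖∑ n ∈ Finset.range N,
      (S n (Hb.taylor hUo h0 n f) - Hb.taylor hUo h0 n f) (x : E)‖ ≤ δ / 2 := by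
    refine (norm_sum_le_of_le _ fun n _ => hterm n).trans ?_
    rw [Finset.sum_const, Finset.card_range, nsmul_eq_mul, mul_div_assoc', div_le_div_iff₀
      (by positivity) (by positivity)]
    nlinarith
  have hval : (((∑ n ∈ Finset.range N,
      ((Hb.ofHomPoly U n).comp (S n)).comp (Hb.taylor hUo h0 n)) f) - f).val x =
      ∑ n ∈ Finset.range N, (S n (Hb.taylor hUo h0 n f) - Hb.taylor hUo h0 n f) (x : E) +
        (∑ n ∈ Finset.range N, Hb.taylor hUo h0 n f (x : E) - f.val x) := by
    rw [Hb.val_sub, sum_apply, Hb.val_sum]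
    simp only [HomPoly.sub_apply, Finset.sum_sub_distrib, ContinuousLinearMap.comp_apply,
      Hb.val_ofHomPoly]
    ring
  rw [hval]
  refine (norm_add_le _ _).trans_lt ?_
  linarith [hN f hf x hx]

theorem HasAPLC.hasAP_strongDual {U : Set E} (hUo : IsOpen U) (h0 : (0 : E) ∈ U)
    (h : I.HasAPLC (Hb U)) : I.HasAP (StrongDual ℂ E) :=
  (h.hasAP_of_retract (Hb.ofHomPoly U 1) (Hb.taylor hUo h0 1)
    (Hb.taylor_one_ofHomPoly hUo h0)).strongDual_of_homPoly le_rfl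

end OperatorIdeal

theorem mainTheorem7 (I : OperatorIdeal.{u}) (hI : I.FactorizationLeComposition)
    (hdual : I.LeDual ∨ I.DualLe)
    (E : Type u) [NormedAddCommGroup E] [NormedSpace ℂ E] [CompleteSpace E]
    (hE : PolynomiallyReflexive E)
    (U : Set E) (hUo : IsOpen U) (hUb : Balanced ℂ U) (hUne : U.Nonempty) :
    List.TFAE
      [I.HasAP E,
       ∀ n : ℕ, 1 ≤ n → I.HasAP (HomPoly n E),
       ∃ n : ℕ, 1 ≤ n ∧ I.HasAP (HomPoly n E),
       I.HasAPLC (Hb U)] := by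
  have h0 : (0 : E) ∈ U := hUb.zero_mem hUne
  have hEr := hE.isReflexiveSpace
  tfae_have 1 → 2 := fun h n hn => h.homPoly hI hdual hn (hE n hn)
  tfae_have 2 → 3 := fun h => ⟨1, le_rfl, h 1 le_rfl⟩
  tfae_have 3 → 1 := fun ⟨n, hn, h⟩ => (h.strongDual_of_homPoly hn).of_strongDual hI hdual hEr
  tfae_have 2 → 4 := fun h => OperatorIdeal.hasAPLC_hb hUo hUb h0 fun n => by
    rcases n with - | n
    · exact OperatorIdeal.hasAP_homPoly_zero
    · exact h _ n.succ_pos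
  tfae_have 4 → 1 := fun h => (h.hasAP_strongDual hUo h0).of_strongDual hI hdual hEr
  tfae_finish
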